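/- Let $\mathfrak{e}(2)$ be the three-dimensional complex Lie algebra with basis $p_+,p_-,l$ and brackets $[p_+,p_-]=0$, $[l,p_\pm]=\pm p_\pm$ (the complexification of the Lie algebra of the Euclidean group of motions of the plane). By an $\mathfrak{e}(2)$-module we mean a finite-dimensional complex representation $V$ of $\mathfrak{e}(2)$ on which $l$ acts semisimply with integer eigenvalues; for $k\in\mathbb{Z}$ write $V_k=\{v\in V \mid l\cdot v=kv\}$. A module is indecomposable if it is nonzero and is not the direct sum of two nonzero submodules. Let $A$ be a finite subset of $\mathbb{Z}$ which does not contain any five consecutive integers. Then there are only finitely many isomorphism classes of indecomposable $\mathfrak{e}(2)$-modules $V$ such that $V_k=0$ for all $k\in\mathbb{Z}\setminus A$. -/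

import Mathlib

universe u

namespace Euclidean

/-- The underlying vector space of the complex Euclidean Lie algebra `𝔢(2)`: the element `x`
stands for `x 0 • p₊ + x 1 • p₋ + x 2 • l`. -/
def E2 : Type := Fin 3 → ℂ

namespace E2

noncomputable instance : AddCommGroup E2 := inferInstanceAs (AddCommGroup (Fin 3 → ℂ))

noncomputable instance : Module ℂ E2 := inferInstanceAs (Module ℂ (Fin 3 → ℂ))

@[ext] theorem ext {x y : E2} (h : ∀ i : Fin 3, x i = y i) : x = y := funext h

@[simp] theorem add_apply (x y : E2) (i : Fin 3) : (x + y) i = x i + y i := rfl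

@[simp] theorem zero_apply (i : Fin 3) : (0 : E2) i = 0 := rfl

@[simp] theorem neg_apply (x : E2) (i : Fin 3) : (-x) i = -x i := rfl

@[simp] theorem smul_apply (c : ℂ) (x : E2) (i : Fin 3) : (c • x) i = c * x i := rfl

/-- The bilinear alternating bracket determined by `[p₊, p₋] = 0`, `[l, p₊] = p₊` and
`[l, p₋] = -p₋`. -/
noncomputable instance : Bracket E2 E2 where
  bracket x y := (![x 2 * y 0 - x 0 * y 2, -(x 2 * y 1 - x 1 * y 2), 0] : Fin 3 → ℂ)

@[simp] theorem bracket_zero (x y : E2) : ⁅x, y⁆ 0 = x 2 * y 0 - x 0 * y 2 := rfl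

@[simp] theorem bracket_one (x y : E2) : ⁅x, y⁆ 1 = -(x 2 * y 1 - x 1 * y 2) := rfl

@[simp] theorem bracket_two (x y : E2) : ⁅x, y⁆ 2 = 0 := rfl

noncomputable instance : LieRing E2 where
  add_lie x y z := by
    ext i; fin_cases i <;> simp <;> ring
  lie_add x y z := by
    ext i; fin_cases i <;> simp <;> ring
  lie_self x := by
    ext i; fin_cases i <;> simp <;> ring
  leibniz_lie x y z := by
    ext i; fin_cases i <;> simp <;> ring

noncomputable instance : LieAlgebra ℂ E2 where
  lie_smul c x y := by
    ext i; fin_cases i <;> simp <;> ring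

/-- The basis `p₊, p₋, l` of `𝔢(2)`. -/
noncomputable def basis : Module.Basis (Fin 3) ℂ E2 := Pi.basisFun ℂ (Fin 3)

/-- The basis vector `p₊`. -/
noncomputable def pPlus : E2 := basis 0

/-- The basis vector `p₋`. -/
noncomputable def pMinus : E2 := basis 1

/-- The basis vector `l`. -/
noncomputable def l : E2 := basis 2

theorem basis_apply (i j : Fin 3) : basis i j = if j = i then 1 else 0 := by
  change (Pi.basisFun ℂ (Fin 3) i : Fin 3 → ℂ) j = _
  simp [Pi.single_apply]

theorem lie_pPlus_pMinus : ⁅pPlus, pMinus⁆ = 0 := by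
  ext i; fin_cases i <;> simp [pPlus, pMinus, basis_apply]

theorem lie_l_pPlus : ⁅l, pPlus⁆ = pPlus := by
  ext i; fin_cases i <;> simp [pPlus, l, basis_apply]

theorem lie_l_pMinus : ⁅l, pMinus⁆ = -pMinus := by
  ext i; fin_cases i <;> simp [pMinus, l, basis_apply]

end E2

/-- The `k`-weight space `V_k = {v ∈ V | l · v = k v}`. -/
noncomputable def weightSpace (V : Type u) [AddCommGroup V] [Module ℂ V] [LieRingModule E2 V]
    [LieModule ℂ E2 V] (k : ℤ) : Submodule ℂ V :=
  (LieModule.toEnd ℂ E2 V E2.l).eigenspace (k : ℂ)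

theorem mem_weightSpace {V : Type u} [AddCommGroup V] [Module ℂ V] [LieRingModule E2 V]
    [LieModule ℂ E2 V] {k : ℤ} {v : V} :
    v ∈ weightSpace V k ↔ ⁅E2.l, v⁆ = (k : ℂ) • v := by
  simp [weightSpace]

/-- An `𝔢(2)`-module: a finite-dimensional complex representation of the Lie algebra `𝔢(2)` on
which `l` acts semisimply with integer eigenvalues. -/
structure E2Mod : Type (u + 1) where
  carrier : Type u
  [addCommGroup : AddCommGroup carrier]
  [module : Module ℂ carrier]
  [lieRingModule : LieRingModule E2 carrier]
  [lieModule : LieModule ℂ E2 carrier]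
  [finiteDimensional : FiniteDimensional ℂ carrier]
  semisimple : (LieModule.toEnd ℂ E2 carrier E2.l).IsSemisimple
  integral : ∀ z : ℂ, (LieModule.toEnd ℂ E2 carrier E2.l).HasEigenvalue z → ∃ k : ℤ, z = k

namespace E2Mod

attribute [instance] addCommGroup module lieRingModule lieModule finiteDimensional

/-- The module is the span of its weight spaces. -/
theorem iSup_weightSpace (V : E2Mod.{u}) : ⨆ k : ℤ, weightSpace V.carrier k = ⊤ := by
  rw [eq_top_iff, ← Module.End.iSup_maxGenEigenspace_eq_top
    (LieModule.toEnd ℂ E2 V.carrier E2.l)]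
  refine iSup_le fun z => ?_
  rw [V.semisimple.isFinitelySemisimple.maxGenEigenspace_eq_eigenspace]
  by_cases hz : (LieModule.toEnd ℂ E2 V.carrier E2.l).HasEigenvalue z
  · obtain ⟨k, rfl⟩ := V.integral z hz
    exact le_iSup (fun k : ℤ => weightSpace V.carrier k) k
  · rw [Module.End.hasEigenvalue_iff, not_not] at hz
    simp [hz]

/-- An `𝔢(2)`-module is indecomposable if it is nonzero and is not the direct sum of two nonzero
submodules. -/
def Indecomposable (V : E2Mod.{u}) : Prop :=
  Nontrivial V.carrier ∧
    ∀ N₁ N₂ : LieSubmodule ℂ E2 V.carrier, IsCompl N₁ N₂ → N₁ = ⊥ ∨ N₂ = ⊥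

/-- All weights of `V` lie in `A`, i.e. `V_k = 0` for `k ∉ A`. -/
def SupportedOn (V : E2Mod.{u}) (A : Set ℤ) : Prop :=
  ∀ k : ℤ, k ∉ A → weightSpace V.carrier k = ⊥

/-- Isomorphism of `𝔢(2)`-modules. -/
instance isoSetoid : Setoid E2Mod.{u} where
  r V W := Nonempty (V.carrier ≃ₗ⁅ℂ, E2⁆ W.carrier)
  iseqv :=
    { refl := fun _ => ⟨LieModuleEquiv.refl⟩
      symm := fun ⟨e⟩ => ⟨e.symm⟩
      trans := fun ⟨e⟩ ⟨f⟩ => ⟨e.trans f⟩ }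

/-- The isomorphism classes of `𝔢(2)`-modules. -/
def IsoClass : Type (u + 1) := Quotient isoSetoid.{u}

/-- The isomorphism class of an `𝔢(2)`-module. -/
def isoClass (V : E2Mod.{u}) : IsoClass.{u} := Quotient.mk isoSetoid V

end E2Mod

end Euclidean

/-! Since `p₊` and `p₋` shift weights by one, a gap in the weights splits a module, so an
indecomposable one lives on at most four consecutive weights (`exists_interval`). As `p₊` and `p₋`
commute, its weight spaces form a representation of the preprojective algebra of type A₄, up to
signs (`rep`), which is again indecomposable (`Indecomposable.rep_indec`). That algebra has finite
representation type, which is proved in the form `Rep4.Indec.nice`: a nonzero indecomposable has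
bases of at most two vectors per vertex with all matrix entries in {-1, 0, 1}. A module is then
determined by at most eight weights from `A` and two sign matrices, and such data are finite in
number.

Summands are recognised by duality. Vectors and equally many functionals with invertible pairing
split a space into a span and a joint kernel (`DualPair.isCompl`). If all arrows respect both,
indecomposability kills the joint kernels and the vectors become bases (`Indec.nice_of_dualPair`).
What happens at an outer vertex depends on the position of the vectors and functionals relative to
the flag 0 ≤ image ≤ kernel ≤ everything in the adjacent middle space (`side_single`, `side_full`,
`side_diag`).

Write a, b for `a₂`, `b₂`. In a representation that is not nice no candidate summand occurs, and
each exclusion yields an identity or an inclusion: first aba = 0 and bab = 0, then ker(ba) ⊆ im(ba)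
and, by the symmetry `flip`, ker(ab) ⊆ im(ab). Together these make both middle spaces vanish, which
leaves only simples at the ends. -/

namespace Euclidean

open Module Submodule

/-! ### Linear algebra: sign combinations, dual pairs and extension of functionals -/

section Combinations

variable {V W : Type u} [AddCommGroup V] [Module ℂ V] [AddCommGroup W] [Module ℂ W]

/-- `v` is a linear combination of the `e i` with coefficients in `{-1, 0, 1}`. -/
def SignComb {n : ℕ} (e : Fin n → V) (v : V) : Prop :=
  ∃ t : Fin n → SignType, v = ∑ i, ((t i : SignType) : ℂ) • e i

theorem SignComb.zero {n : ℕ} (e : Fin n → V) : SignComb e 0 := ⟨0, by simp⟩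

theorem SignComb.self {n : ℕ} (e : Fin n → V) (i : Fin n) : SignComb e (e i) :=
  ⟨Pi.single i 1, by
    rw [Finset.sum_eq_single i] <;> simp +contextual⟩

theorem SignComb.neg {n : ℕ} {e : Fin n → V} {v : V} (h : SignComb e v) : SignComb e (-v) := by
  obtain ⟨t, rfl⟩ := h
  refine ⟨fun i => -t i, ?_⟩
  rw [← Finset.sum_neg_distrib]
  refine Finset.sum_congr rfl fun i _ => ?_
  dsimp only
  generalize t i = s
  cases s <;> simp

theorem SignComb.mem_span {n : ℕ} {e : Fin n → V} {v : V} (h : SignComb e v) :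
    v ∈ span ℂ (Set.range e) := by
  obtain ⟨t, rfl⟩ := h
  exact sum_mem fun i _ => smul_mem _ _ (subset_span ⟨i, rfl⟩)

/-- The pairing between the vectors `e j` and the functionals `φ i` is nondegenerate. -/
def DualPair {n : ℕ} (e : Fin n → V) (φ : Fin n → Dual ℂ V) : Prop :=
  ∀ t : Fin n → ℂ, (∀ i, φ i (∑ j, t j • e j) = 0) → t = 0

theorem DualPair.empty (e : Fin 0 → V) (φ : Fin 0 → Dual ℂ V) : DualPair e φ :=
  fun _ _ => Subsingleton.elim _ _

theorem DualPair.single {x : V} {ξ : Dual ℂ V} (h : ξ x = 1) : DualPair ![x] ![ξ] := by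
  intro t ht
  ext i
  have := ht 0
  fin_cases i
  simpa [h] using this

theorem DualPair.pair {x y : V} {ξ η : Dual ℂ V} (hx : ξ x = 1) (hy : η y = 1)
    (h : ξ y = 0 ∨ η x = 0) : DualPair ![x, y] ![ξ, η] := by
  intro t ht
  have h0 := ht 0
  have h1 := ht 1
  simp only [Fin.sum_univ_two, Matrix.cons_val_zero, Matrix.cons_val_one, map_add, map_smul,
    smul_eq_mul, hx, hy] at h0 h1
  have : t 0 = 0 ∧ t 1 = 0 := by
    rcases h with h | h <;> simp_all
  ext i
  fin_cases i
  exacts [this.1, this.2]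

/-- The joint kernel of a family of functionals. -/
def coKernel {n : ℕ} (φ : Fin n → Dual ℂ V) : Submodule ℂ V := LinearMap.ker (LinearMap.pi φ)

theorem mem_coKernel {n : ℕ} {φ : Fin n → Dual ℂ V} {v : V} :
    v ∈ coKernel φ ↔ ∀ i, φ i v = 0 := by
  simp [coKernel, funext_iff]

theorem DualPair.linearIndependent {n : ℕ} {e : Fin n → V} {φ : Fin n → Dual ℂ V}
    (h : DualPair e φ) : LinearIndependent ℂ e := by
  rw [Fintype.linearIndependent_iff]
  intro t ht i
  rw [h t (by simp [ht])]
  rfl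

/-- The pairing matrix is square and injective, hence surjective: every v can be corrected by a
combination of the `e j` so that all `φ i` vanish on it. `V` itself may have any dimension. -/
theorem DualPair.isCompl {n : ℕ} {e : Fin n → V} {φ : Fin n → Dual ℂ V}
    (h : DualPair e φ) : IsCompl (span ℂ (Set.range e)) (coKernel φ) := by
  let g : (Fin n → ℂ) →ₗ[ℂ] V := Fintype.linearCombination ℂ e
  have hg : ∀ t, g t = ∑ j, t j • e j := fun t => Fintype.linearCombination_apply ..
  have hr : span ℂ (Set.range e) = LinearMap.range g := (Fintype.range_linearCombination ℂ e).symm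
  have hinj : Function.Injective (LinearMap.pi φ ∘ₗ g) := by
    rw [← LinearMap.ker_eq_bot, LinearMap.ker_eq_bot']
    intro t ht
    refine h t fun i => ?_
    rw [← hg]
    exact congrFun ht i
  have hsurj := LinearMap.injective_iff_surjective.1 hinj
  rw [hr]
  constructor
  · rw [disjoint_iff_inf_le]
    rintro _ ⟨⟨t, rfl⟩, ht⟩
    have : t = 0 := by
      refine h t fun i => ?_
      rw [← hg]
      exact mem_coKernel.1 ht i
    simp [this]
  · rw [codisjoint_iff_le_sup]
    intro v _
    obtain ⟨t, ht⟩ := hsurj (LinearMap.pi φ v)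
    rw [Submodule.mem_sup]
    refine ⟨g t, ⟨t, rfl⟩, v - g t, ?_, by abel⟩
    change LinearMap.pi φ (v - g t) = 0
    rw [map_sub, ← ht]
    exact sub_self _

/-- `f` maps the vectors `e` to signed combinations of `e'`, and the joint kernel of `φ` into that
of `φ'`. -/
def Adapted {n n' : ℕ} (f : V →ₗ[ℂ] W) (e : Fin n → V) (φ : Fin n → Dual ℂ V)
    (e' : Fin n' → W) (φ' : Fin n' → Dual ℂ W) : Prop :=
  (∀ j, SignComb e' (f (e j))) ∧ ∀ v, (∀ j, φ j v = 0) → ∀ i, φ' i (f v) = 0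

theorem Adapted.span_le {n n' : ℕ} {f : V →ₗ[ℂ] W} {e : Fin n → V} {φ : Fin n → Dual ℂ V}
    {e' : Fin n' → W} {φ' : Fin n' → Dual ℂ W} (h : Adapted f e φ e' φ') :
    span ℂ (Set.range e) ≤ (span ℂ (Set.range e')).comap f := by
  rw [Submodule.span_le]
  rintro _ ⟨j, rfl⟩
  exact (h.1 j).mem_span

theorem Adapted.coKernel_le {n n' : ℕ} {f : V →ₗ[ℂ] W} {e : Fin n → V} {φ : Fin n → Dual ℂ V}
    {e' : Fin n' → W} {φ' : Fin n' → Dual ℂ W} (h : Adapted f e φ e' φ') :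
    coKernel φ ≤ (coKernel φ').comap f := fun v hv =>
  mem_coKernel.2 (h.2 v (mem_coKernel.1 hv))

/-- A dual pair at the outer vertex compatible with a given one at the inner vertex. -/
def Side {n : ℕ} (a : V →ₗ[ℂ] W) (b : W →ₗ[ℂ] V) (e : Fin n → W) (φ : Fin n → Dual ℂ W) : Prop :=
  ∃ m, m ≤ 2 ∧ ∃ (e' : Fin m → V) (φ' : Fin m → Dual ℂ V), DualPair e' φ' ∧
    Adapted b e φ e' φ' ∧ Adapted a e' φ' e φ

theorem exists_functional {p : Submodule ℂ V} {x : V} (hx : x ∉ p) :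
    ∃ ξ : Dual ℂ V, ξ x = 1 ∧ ∀ y ∈ p, ξ y = 0 := by
  obtain ⟨f, hf, hp⟩ := Submodule.exists_le_ker_of_notMem hx
  refine ⟨(f x)⁻¹ • f, by simp [hf], fun y hy => ?_⟩
  have : f y = 0 := hp hy
  simp [this]

/-- The range of the dual map is the annihilator of the kernel. This is how functionals are
transported along arrows, where vectors would be transported by taking images. -/
theorem exists_factor (f : V →ₗ[ℂ] W) (ξ : Dual ℂ V) (h : ∀ v, f v = 0 → ξ v = 0) :
    ∃ θ : Dual ℂ W, ∀ v, θ (f v) = ξ v := by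
  have : ξ ∈ LinearMap.range f.dualMap := by
    rw [LinearMap.range_dualMap_eq_dualAnnihilator_ker, Submodule.mem_dualAnnihilator]
    exact fun v hv => h v hv
  obtain ⟨θ, rfl⟩ := this
  exact ⟨θ, fun v => rfl⟩

/-- The pair (ξ, -ζ) is a single functional on `V × V`. The required conditions say that it is 1 at
(x, 0) and vanishes on B × 0, 0 × K, the diagonal of F and F₀ × 0; the hypothesis says exactly that
(x, 0) lies outside the sum of these. -/
theorem exists_functional_pair {B K F F₀ : Submodule ℂ V} {x : V}
    (hx : ∀ b ∈ B, ∀ k ∈ K, ∀ f₀ ∈ F₀, k ∈ F → x ≠ b + f₀ + k) :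
    ∃ ξ ζ : Dual ℂ V, ξ x = 1 ∧ (∀ v ∈ B, ξ v = 0) ∧ (∀ v ∈ K, ζ v = 0) ∧
      (∀ v ∈ F, ξ v = ζ v) ∧ (∀ v ∈ F₀, ξ v = 0) := by
  have hxp : ((x, 0) : V × V) ∉
      B.prod ⊥ ⊔ (⊥ : Submodule ℂ V).prod K ⊔ F.map (LinearMap.id.prod LinearMap.id) ⊔
        F₀.prod ⊥ := by
    intro h
    simp only [Submodule.mem_sup, Submodule.mem_prod, Submodule.mem_map, Submodule.mem_bot] at h
    obtain ⟨_, ⟨_, ⟨⟨b, b'⟩, ⟨hb, hb'⟩, ⟨k', k⟩, ⟨hk', hk⟩, rfl⟩, _, ⟨f, hf, rfl⟩, rfl⟩,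
      ⟨f₀, f₀'⟩, ⟨hf₀, hf₀'⟩, h⟩ := h
    have hb' : b' = 0 := hb'
    have hk' : k' = 0 := hk'
    have hf₀' : f₀' = 0 := hf₀'
    subst hb' hk' hf₀'
    have h1 : b + 0 + f + f₀ = x := congrArg Prod.fst h
    have h2 : 0 + k + f + 0 = 0 := congrArg Prod.snd h
    have hkf : f = -k := by
      rw [zero_add, add_zero] at h2
      exact eq_neg_of_add_eq_zero_right h2
    refine hx b hb f (hkf ▸ K.neg_mem hk) f₀ hf₀ hf ?_
    rw [← h1]
    abel
  obtain ⟨g, hg, hp⟩ := exists_functional hxp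
  refine ⟨g ∘ₗ LinearMap.inl ℂ V V, -(g ∘ₗ LinearMap.inr ℂ V V), by simpa using hg, ?_, ?_, ?_, ?_⟩
  · exact fun v hv => hp _ (mem_sup_left (mem_sup_left (mem_sup_left ⟨hv, rfl⟩)))
  · intro v hv
    have := hp (0, v) (mem_sup_left (mem_sup_left (mem_sup_right ⟨rfl, hv⟩)))
    simpa using this
  · intro v hv
    have := hp (v, v) (mem_sup_left (mem_sup_right ⟨v, hv, rfl⟩))
    have h2 : ((v, v) : V × V) = (v, 0) + (0, v) := by simp
    rw [h2, map_add] at this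
    simpa using eq_neg_of_add_eq_zero_left this
  · exact fun v hv => hp _ (mem_sup_right ⟨hv, rfl⟩)

end Combinations

/-! ### Extending dual pairs to an outer vertex -/

section Side

variable {V W : Type u} [AddCommGroup V] [Module ℂ V] [AddCommGroup W] [Module ℂ W]
  {a : V →ₗ[ℂ] W} {b : W →ₗ[ℂ] V}

/-- The filtration `0 ≤ im a ≤ ker b ≤ W` attached to maps `a : V → W` and `b : W → V`. -/
def outerFlag (a : V →ₗ[ℂ] W) (b : W →ₗ[ℂ] V) : ℕ → Submodule ℂ W
  | 0 => ⊥
  | 1 => LinearMap.range a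
  | 2 => LinearMap.ker b
  | _ => ⊤

theorem side_empty (e : Fin 0 → W) (φ : Fin 0 → Dual ℂ W) : Side a b e φ :=
  ⟨0, by omega, ![], ![], .empty _ _, ⟨fun j => j.elim0, fun _ _ i => i.elim0⟩,
    fun j => j.elim0, fun _ _ i => i.elim0⟩

/-- The step of the flag at which `x` enters and `ξ` still vanishes decides the outer vertex: a
preimage of `x` under `a` for i = 0, nothing for i = 1, the vector `b x` for i = 2. Beyond that the
flag is everything, contradicting `ξ x = 1`. -/
theorem side_single (hba : ∀ v, b (a v) = 0) {x : W} {ξ : Dual ℂ W} (hξ : ξ x = 1)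
    (hab : ∀ w, ξ (a (b w)) = 0) (hx : a (b x) = 0) {i : ℕ} (hxi : x ∈ outerFlag a b (i + 1))
    (hξi : ∀ w ∈ outerFlag a b i, ξ w = 0) : Side a b ![x] ![ξ] := by
  match i with
  | 0 =>
    obtain ⟨u, rfl⟩ := hxi
    refine ⟨1, by omega, ![u], ![ξ ∘ₗ a], .single hξ, ⟨?_, ?_⟩, ?_, ?_⟩
    · simpa [Fin.forall_fin_one, hba] using SignComb.zero _
    · intro v _; simpa [Fin.forall_fin_one] using hab v
    · simpa [Fin.forall_fin_one] using SignComb.self ![a u] 0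
    · intro v hv; simpa [Fin.forall_fin_one] using hv
  | 1 =>
    have hb : b x = 0 := hxi
    refine ⟨0, by omega, ![], ![], .empty _ _, ⟨?_, ?_⟩, ?_, ?_⟩
    · simpa [Fin.forall_fin_one, hb] using SignComb.zero _
    · intro v _ i; exact i.elim0
    · intro j; exact j.elim0
    · intro v hv; simpa [Fin.forall_fin_one] using hξi _ ⟨v, rfl⟩
  | 2 =>
    obtain ⟨ν, hν⟩ := exists_factor b ξ hξi
    refine ⟨1, by omega, ![b x], ![ν], .single ((hν x).trans hξ), ⟨?_, ?_⟩, ?_, ?_⟩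
    · simpa [Fin.forall_fin_one] using SignComb.self ![b x] 0
    · intro v hv; simpa [Fin.forall_fin_one, hν] using hv
    · simpa [Fin.forall_fin_one, hx] using SignComb.zero _
    · intro v _; simpa [Fin.forall_fin_one] using hξi _ (hba v)
  | i + 3 =>
    have := hξi x trivial
    simp [hξ] at this

theorem side_full (hba : ∀ v, b (a v) = 0) {x : W} {θ : Dual ℂ W} (hθ : θ (a (b x)) = 1) :
    Side a b ![x, a (b x)] ![θ ∘ₗ a ∘ₗ b, θ] := by
  refine ⟨1, by omega, ![b x], ![θ ∘ₗ a], .single hθ, ⟨?_, ?_⟩, ?_, ?_⟩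
  · refine Fin.forall_fin_two.2 ⟨SignComb.self ![b x] 0, ?_⟩
    simpa [hba] using SignComb.zero _
  · intro v hv; simpa [Fin.forall_fin_one] using hv 0
  · simpa [Fin.forall_fin_one] using SignComb.self ![x, a (b x)] 1
  · intro v hv
    refine Fin.forall_fin_two.2 ⟨by simp [hba], hv 0⟩

/-- Here neither `x` nor `z` is adapted to the flag: it is `x + z` that sits in the smaller step,
and dually `ξ - ζ` that kills the larger one. A preimage of `x + z` or a factorisation of `ξ - ζ`
through `b` gives the outer vertex. Since `b (x + z) = 0`, one gets `b z = -b x`, the source of the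
entries -1. -/
theorem side_diag (hba : ∀ v, b (a v) = 0) {x z : W} {ξ ζ : Dual ℂ W} (hξ : ξ x = 1)
    (hξz : ξ z = 0) (hζx : ζ x = 0)
    (hξab : ∀ w, ξ (a (b w)) = 0) (hx : a (b x) = 0)
    {i j : ℕ} (hij : i < j) (hj : j ≤ 2)
    (hs : x + z ∈ outerFlag a b (i + 1)) (hxj : x ∈ outerFlag a b (j + 1))
    (hi : ∀ w ∈ outerFlag a b i, ξ w = 0) (h : ∀ w ∈ outerFlag a b j, ξ w = ζ w) :
    Side a b ![x, z] ![ξ, ζ] := by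
  -- Used when j = 2, where step j of the flag is the kernel of `b`.
  have main : ∀ (h2 : ∀ w, b w = 0 → ξ w = ζ w), ∃ ν : Dual ℂ V, ∀ w, ν (b w) = ξ w - ζ w := by
    intro h2
    obtain ⟨ν, hν⟩ := exists_factor b (ξ - ζ) (fun v hv => by simp [h2 v hv])
    exact ⟨ν, by simpa using hν⟩
  have hbz : b (x + z) = 0 → b z = - b x := fun h => by
    rw [map_add] at h; exact eq_neg_of_add_eq_zero_right h
  obtain ⟨rfl, rfl⟩ | ⟨rfl, rfl⟩ | ⟨rfl, rfl⟩ : (i = 0 ∧ j = 1) ∨ (i = 0 ∧ j = 2) ∨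
    (i = 1 ∧ j = 2) := by omega
  · obtain ⟨u, hu⟩ := hs
    have hbx : b x = 0 := hxj
    have hbz : b z = 0 := by rw [hbz (by rw [← hu, hba]), hbx, neg_zero]
    refine ⟨1, by omega, ![u], ![ξ ∘ₗ a], .single (by simp [hu, hξ, hξz]), ⟨?_, ?_⟩, ?_, ?_⟩
    · refine Fin.forall_fin_two.2 ⟨?_, ?_⟩
      · simpa [hbx] using SignComb.zero _
      · simpa [hbz] using SignComb.zero _
    · intro v _; simpa [Fin.forall_fin_one] using hξab v
    · refine Fin.forall_fin_one.2 ⟨1, ?_⟩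
      simp [hu]
    · intro v hv
      have h1 : ξ (a v) = 0 := hv 0
      exact Fin.forall_fin_two.2 ⟨h1, by simpa [h1] using (h _ ⟨v, rfl⟩).symm⟩
  · obtain ⟨u, hu⟩ := hs
    have hbz := hbz (by rw [← hu, hba])
    obtain ⟨ν, hν⟩ := main h
    refine ⟨2, by omega, ![u, b x], ![ξ ∘ₗ a, ν],
      .pair (by simp [hu, hξ, hξz]) (by simp [hν, hξ, hζx]) (.inl (hξab x)), ⟨?_, ?_⟩, ?_, ?_⟩
    · refine Fin.forall_fin_two.2 ⟨SignComb.self ![u, b x] 1, ?_⟩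
      have := (SignComb.self ![u, b x] 1).neg
      simpa [hbz] using this
    · intro v hv
      have h0 : ξ v = 0 := hv 0
      have h1 : ζ v = 0 := hv 1
      exact Fin.forall_fin_two.2 ⟨hξab v, by simp [hν, h0, h1]⟩
    · refine Fin.forall_fin_two.2 ⟨⟨1, by simp [hu]⟩, ?_⟩
      simpa [hx] using SignComb.zero _
    · intro v hv
      have h1 : ξ (a v) = 0 := hv 0
      exact Fin.forall_fin_two.2 ⟨h1, by simpa [h1] using (h _ (hba v)).symm⟩
  · have hbz := hbz hs
    obtain ⟨ν, hν⟩ := main h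
    refine ⟨1, by omega, ![b x], ![ν], .single (by simp [hν, hξ, hζx]), ⟨?_, ?_⟩, ?_, ?_⟩
    · refine Fin.forall_fin_two.2 ⟨SignComb.self ![b x] 0, ?_⟩
      have := (SignComb.self ![b x] 0).neg
      simpa [hbz] using this
    · intro v hv
      have h0 : ξ v = 0 := hv 0
      have h1 : ζ v = 0 := hv 1
      exact Fin.forall_fin_one.2 (by simp [hν, h0, h1])
    · refine Fin.forall_fin_one.2 ?_
      simpa [hx] using SignComb.zero _
    · intro v _
      have h1 : ξ (a v) = 0 := hi _ ⟨v, rfl⟩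
      exact Fin.forall_fin_two.2 ⟨h1, by simpa [h1] using (h _ (hba v)).symm⟩

end Side

/-! ### Representations of type A₄ and the splitting criterion -/

/-- A representation of the preprojective algebra of type `A₄` over `ℂ`, up to signs. -/
structure Rep4 : Type (u + 1) where
  {V₁ V₂ V₃ V₄ : Type u}
  [g₁ : AddCommGroup V₁] [g₂ : AddCommGroup V₂] [g₃ : AddCommGroup V₃] [g₄ : AddCommGroup V₄]
  [m₁ : Module ℂ V₁] [m₂ : Module ℂ V₂] [m₃ : Module ℂ V₃] [m₄ : Module ℂ V₄]
  a₁ : V₁ →ₗ[ℂ] V₂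
  b₁ : V₂ →ₗ[ℂ] V₁
  a₂ : V₂ →ₗ[ℂ] V₃
  b₂ : V₃ →ₗ[ℂ] V₂
  a₃ : V₃ →ₗ[ℂ] V₄
  b₃ : V₄ →ₗ[ℂ] V₃
  rel₁ : ∀ v, b₁ (a₁ v) = 0
  rel₂ : ∀ v, a₁ (b₁ v) = b₂ (a₂ v)
  rel₃ : ∀ v, b₃ (a₃ v) = a₂ (b₂ v)
  rel₄ : ∀ v, a₃ (b₃ v) = 0

namespace Rep4

attribute [instance] g₁ g₂ g₃ g₄ m₁ m₂ m₃ m₄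

/-- The representation obtained by reversing the order of the vertices. -/
def flip (R : Rep4.{u}) : Rep4.{u} where
  V₁ := R.V₄
  V₂ := R.V₃
  V₃ := R.V₂
  V₄ := R.V₁
  a₁ := R.b₃
  b₁ := R.a₃
  a₂ := R.b₂
  b₂ := R.a₂
  a₃ := R.b₁
  b₃ := R.a₁
  rel₁ := R.rel₄
  rel₂ := R.rel₃
  rel₃ := R.rel₂
  rel₄ := R.rel₁

variable (R : Rep4.{u})

/-- The given subspaces form a subrepresentation. -/
structure Stable (M₁ : Submodule ℂ R.V₁) (M₂ : Submodule ℂ R.V₂) (M₃ : Submodule ℂ R.V₃)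
    (M₄ : Submodule ℂ R.V₄) : Prop where
  a₁ : M₁ ≤ M₂.comap R.a₁
  b₁ : M₂ ≤ M₁.comap R.b₁
  a₂ : M₂ ≤ M₃.comap R.a₂
  b₂ : M₃ ≤ M₂.comap R.b₂
  a₃ : M₃ ≤ M₄.comap R.a₃
  b₃ : M₄ ≤ M₃.comap R.b₃

/-- The representation is not a direct sum of two nonzero subrepresentations. -/
def Indec : Prop :=
  ∀ (M₁ N₁ : Submodule ℂ R.V₁) (M₂ N₂ : Submodule ℂ R.V₂) (M₃ N₃ : Submodule ℂ R.V₃)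
    (M₄ N₄ : Submodule ℂ R.V₄), R.Stable M₁ M₂ M₃ M₄ → R.Stable N₁ N₂ N₃ N₄ →
    IsCompl M₁ N₁ → IsCompl M₂ N₂ → IsCompl M₃ N₃ → IsCompl M₄ N₄ →
    (M₁ = ⊥ ∧ M₂ = ⊥ ∧ M₃ = ⊥ ∧ M₄ = ⊥) ∨ (N₁ = ⊥ ∧ N₂ = ⊥ ∧ N₃ = ⊥ ∧ N₄ = ⊥)

/-- The representation has bases of at most two vectors at each vertex with respect to which all
matrix entries lie in `{-1, 0, 1}`. -/
def Nice : Prop :=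
  ∃ n₁ n₂ n₃ n₄ : ℕ, n₁ ≤ 2 ∧ n₂ ≤ 2 ∧ n₃ ≤ 2 ∧ n₄ ≤ 2 ∧
    ∃ (e₁ : Basis (Fin n₁) ℂ R.V₁) (e₂ : Basis (Fin n₂) ℂ R.V₂)
      (e₃ : Basis (Fin n₃) ℂ R.V₃) (e₄ : Basis (Fin n₄) ℂ R.V₄),
      (∀ j, SignComb e₂ (R.a₁ (e₁ j))) ∧ (∀ j, SignComb e₁ (R.b₁ (e₂ j))) ∧
      (∀ j, SignComb e₃ (R.a₂ (e₂ j))) ∧ (∀ j, SignComb e₂ (R.b₂ (e₃ j))) ∧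
      (∀ j, SignComb e₄ (R.a₃ (e₃ j))) ∧ (∀ j, SignComb e₃ (R.b₃ (e₄ j)))

variable {R}

theorem Indec.flip (h : R.Indec) : R.flip.Indec := by
  intro M₁ N₁ M₂ N₂ M₃ N₃ M₄ N₄ hM hN h₁ h₂ h₃ h₄
  have := h M₄ N₄ M₃ N₃ M₂ N₂ M₁ N₁ ⟨hM.b₃, hM.a₃, hM.b₂, hM.a₂, hM.b₁, hM.a₁⟩
    ⟨hN.b₃, hN.a₃, hN.b₂, hN.a₂, hN.b₁, hN.a₁⟩ h₄ h₃ h₂ h₁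
  tauto

theorem Nice.of_flip (h : R.flip.Nice) : R.Nice := by
  obtain ⟨n₁, n₂, n₃, n₄, h₁, h₂, h₃, h₄, e₁, e₂, e₃, e₄, k₁, k₂, k₃, k₄, k₅, k₆⟩ := h
  exact ⟨n₄, n₃, n₂, n₁, h₄, h₃, h₂, h₁, e₄, e₃, e₂, e₁, k₆, k₅, k₄, k₃, k₂, k₁⟩

section Splitting

variable {n₂ n₃ : ℕ} {e₂ : Fin n₂ → R.V₂} {φ₂ : Fin n₂ → Dual ℂ R.V₂}
  {e₃ : Fin n₃ → R.V₃} {φ₃ : Fin n₃ → Dual ℂ R.V₃}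

/-- Spans and joint kernels are complementary subrepresentations, so one family is zero. The spans
are not, because `hn` provides a nonzero vector; hence the joint kernels vanish and the vectors
span. -/
theorem Indec.nice_of_dualPair (hR : R.Indec) {n₁ n₄ : ℕ} {e₁ : Fin n₁ → R.V₁}
    {φ₁ : Fin n₁ → Dual ℂ R.V₁} {e₄ : Fin n₄ → R.V₄} {φ₄ : Fin n₄ → Dual ℂ R.V₄}
    (l₁ : n₁ ≤ 2) (l₂ : n₂ ≤ 2) (l₃ : n₃ ≤ 2) (l₄ : n₄ ≤ 2) (hn : 0 < n₁ + n₂ + n₃ + n₄)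
    (h₁ : DualPair e₁ φ₁) (h₂ : DualPair e₂ φ₂) (h₃ : DualPair e₃ φ₃) (h₄ : DualPair e₄ φ₄)
    (ha₁ : Adapted R.a₁ e₁ φ₁ e₂ φ₂) (hb₁ : Adapted R.b₁ e₂ φ₂ e₁ φ₁)
    (ha₂ : Adapted R.a₂ e₂ φ₂ e₃ φ₃) (hb₂ : Adapted R.b₂ e₃ φ₃ e₂ φ₂)
    (ha₃ : Adapted R.a₃ e₃ φ₃ e₄ φ₄) (hb₃ : Adapted R.b₃ e₄ φ₄ e₃ φ₃) : R.Nice := by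
  have key : ∀ {V : Type u} [AddCommGroup V] [Module ℂ V] {n : ℕ} {e : Fin n → V}
      {φ : Fin n → Dual ℂ V}, DualPair e φ → span ℂ (Set.range e) = ⊥ → n = 0 := by
    intro V _ _ n e φ h hb
    by_contra hn
    have := h.linearIndependent.ne_zero ⟨0, Nat.pos_of_ne_zero hn⟩
    exact this ((Submodule.eq_bot_iff _).1 hb _ (subset_span ⟨_, rfl⟩))
  have top : ∀ {V : Type u} [AddCommGroup V] [Module ℂ V] {n : ℕ} {e : Fin n → V}
      {φ : Fin n → Dual ℂ V}, DualPair e φ → coKernel φ = ⊥ → ⊤ ≤ span ℂ (Set.range e) := by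
    intro V _ _ n e φ h hb
    rw [← h.isCompl.sup_eq_top, hb, sup_bot_eq]
  rcases hR _ _ _ _ _ _ _ _
    ⟨ha₁.span_le, hb₁.span_le, ha₂.span_le, hb₂.span_le, ha₃.span_le, hb₃.span_le⟩
    ⟨ha₁.coKernel_le, hb₁.coKernel_le, ha₂.coKernel_le, hb₂.coKernel_le, ha₃.coKernel_le,
      hb₃.coKernel_le⟩ h₁.isCompl h₂.isCompl h₃.isCompl h₄.isCompl with
    ⟨k₁, k₂, k₃, k₄⟩ | ⟨k₁, k₂, k₃, k₄⟩
  · have := key h₁ k₁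
    have := key h₂ k₂
    have := key h₃ k₃
    have := key h₄ k₄
    omega
  · refine ⟨n₁, n₂, n₃, n₄, l₁, l₂, l₃, l₄, Basis.mk h₁.linearIndependent (top h₁ k₁),
      Basis.mk h₂.linearIndependent (top h₂ k₂), Basis.mk h₃.linearIndependent (top h₃ k₃),
      Basis.mk h₄.linearIndependent (top h₄ k₄), ?_⟩
    simp only [Basis.coe_mk]
    exact ⟨ha₁.1, hb₁.1, ha₂.1, hb₂.1, ha₃.1, hb₃.1⟩

theorem Indec.nice_of_side (hR : R.Indec) (l₂ : n₂ ≤ 2) (l₃ : n₃ ≤ 2) (hn : 0 < n₂ + n₃)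
    (h₂ : DualPair e₂ φ₂) (h₃ : DualPair e₃ φ₃)
    (ha₂ : Adapted R.a₂ e₂ φ₂ e₃ φ₃) (hb₂ : Adapted R.b₂ e₃ φ₃ e₂ φ₂)
    (s₁ : Side R.a₁ R.b₁ e₂ φ₂) (s₄ : Side R.b₃ R.a₃ e₃ φ₃) : R.Nice := by
  obtain ⟨n₁, l₁, e₁, φ₁, h₁, hb₁, ha₁⟩ := s₁
  obtain ⟨n₄, l₄, e₄, φ₄, h₄, ha₃, hb₃⟩ := s₄
  exact hR.nice_of_dualPair l₁ l₂ l₃ l₄ (by omega) h₁ h₂ h₃ h₄ ha₁ hb₁ ha₂ hb₂ ha₃ hb₃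

/-- If the second vertex vanishes, then a nonzero first vertex carries a simple summand. -/
theorem Indec.nice_of_subsingleton (hR : R.Indec) (h₂ : ∀ v : R.V₂, v = 0)
    {x : R.V₁} (hx : x ≠ 0) : R.Nice := by
  obtain ⟨ν, hν, -⟩ := exists_functional (p := (⊥ : Submodule ℂ R.V₁)) (x := x) (by simpa using hx)
  refine hR.nice_of_dualPair (e₁ := ![x]) (φ₁ := ![ν]) (e₂ := ![]) (φ₂ := ![]) (e₃ := ![])
    (φ₃ := ![]) (e₄ := ![]) (φ₄ := ![]) (by omega) (by omega) (by omega) (by omega) (by omega)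
    (.single hν) (.empty _ _) (.empty _ _) (.empty _ _) ⟨fun j => ?_, fun _ _ i => i.elim0⟩
    ⟨fun j => j.elim0, fun v _ => ?_⟩ ⟨fun j => j.elim0, fun _ _ i => i.elim0⟩
    ⟨fun j => j.elim0, fun _ _ i => i.elim0⟩ ⟨fun j => j.elim0, fun _ _ i => i.elim0⟩
    ⟨fun j => j.elim0, fun _ _ i => i.elim0⟩
  · rw [h₂ (R.a₁ _)]
    exact .zero _
  · simp [h₂ v]

end Splitting

/-! ### The list of candidate summands -/

/-- The filtration of `V₂` by the image of `a₁` and the kernel of `b₁`. -/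
abbrev flag₂ (R : Rep4.{u}) : ℕ → Submodule ℂ R.V₂ := outerFlag R.a₁ R.b₁

/-- The filtration of `V₃` by the image of `b₃` and the kernel of `a₃`. -/
abbrev flag₃ (R : Rep4.{u}) : ℕ → Submodule ℂ R.V₃ := outerFlag R.b₃ R.a₃

theorem flag₂_mono : ∀ i, R.flag₂ i ≤ R.flag₂ (i + 1)
  | 0 => bot_le
  | 1 => by rintro _ ⟨v, rfl⟩; exact R.rel₁ v
  | 2 => le_top
  | _ + 3 => le_top

/-- A projective summand. -/
theorem Indec.nice_of_length_four (hR : R.Indec) {x : R.V₂} (hx : R.a₂ (R.b₂ (R.a₂ x)) ≠ 0) :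
    R.Nice := by
  -- All vectors are images of the generator `x` and all functionals are pullbacks of `θ`, so the
  -- adaptedness conditions reduce to the relations.
  obtain ⟨θ, hθ, -⟩ := exists_functional (p := (⊥ : Submodule ℂ R.V₃)) (by simpa using hx)
  have s₁ := side_full (a := R.a₁) (b := R.b₁) R.rel₁ (x := x) (θ := θ ∘ₗ R.a₂)
    (by simpa [R.rel₂] using hθ)
  have s₄ := side_full (a := R.b₃) (b := R.a₃) R.rel₄ (x := R.a₂ x) (θ := θ)
    (by simpa [R.rel₃] using hθ)
  have z₁ : ∀ v, R.b₂ (R.a₂ (R.b₂ (R.a₂ v))) = 0 := fun v => by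
    rw [← R.rel₂, ← R.rel₂, R.rel₁, map_zero]
  have z₂ : ∀ v, R.a₂ (R.b₂ (R.a₂ (R.b₂ v))) = 0 := fun v => by
    rw [← R.rel₃, ← R.rel₃, R.rel₄, map_zero]
  refine hR.nice_of_side (by omega) (by omega) (by omega) ?_ ?_ ⟨?_, ?_⟩ ⟨?_, ?_⟩ s₁ s₄
  · exact .pair (by simpa [R.rel₂] using hθ) (by simpa [R.rel₂] using hθ)
      (.inl (by simp [R.rel₂, z₁]))
  · exact .pair (by simpa [R.rel₃] using hθ) (by simpa [R.rel₃] using hθ)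
      (.inl (by simp [R.rel₃, z₂]))
  · refine Fin.forall_fin_two.2 ⟨?_, ?_⟩
    · exact SignComb.self ![R.a₂ x, R.b₃ (R.a₃ (R.a₂ x))] 0
    · have := SignComb.self ![R.a₂ x, R.b₃ (R.a₃ (R.a₂ x))] 1
      simpa [R.rel₂, R.rel₃] using this
  · intro v hv
    have h0 := hv 0
    have h1 := hv 1
    refine Fin.forall_fin_two.2 ⟨?_, ?_⟩
    · simpa [R.rel₂, R.rel₃] using h0
    · simpa using h1
  · refine Fin.forall_fin_two.2 ⟨?_, ?_⟩
    · have := SignComb.self ![x, R.a₁ (R.b₁ x)] 1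
      simpa [R.rel₂] using this
    · simpa [R.rel₃, z₁] using SignComb.zero _
  · intro v hv
    have h0 := hv 0
    refine Fin.forall_fin_two.2 ⟨?_, ?_⟩
    · simp [R.rel₂, z₂]
    · simpa [R.rel₃] using h0

/-- A summand through an arrow from the third to the second vertex. -/
theorem Indec.nice_of_string (hR : R.Indec) {c : R.V₃} {i j : ℕ}
    (hac : R.a₂ (R.b₂ c) = 0) (hi : R.b₂ c ∈ R.flag₂ (i + 1)) (hj : c ∈ R.flag₃ (j + 1))
    (hc : R.b₂ c ∉ LinearMap.range (R.b₂ ∘ₗ R.a₂) ⊔ R.flag₂ i ⊔ (R.flag₃ j).map R.b₂) :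
    R.Nice := by
  obtain ⟨ξ, hξ, hp⟩ := exists_functional hc
  have hba : ∀ v, ξ (R.b₂ (R.a₂ v)) = 0 := fun v =>
    hp _ (mem_sup_left (mem_sup_left ⟨v, rfl⟩))
  have s₁ : Side R.a₁ R.b₁ ![R.b₂ c] ![ξ] := side_single R.rel₁ hξ (by simpa [R.rel₂] using hba)
    (by simp [R.rel₂, hac]) hi (fun w hw => hp _ (mem_sup_left (mem_sup_right hw)))
  have s₄ : Side R.b₃ R.a₃ ![c] ![ξ ∘ₗ R.b₂] := side_single R.rel₄ hξ
    (by simp [R.rel₃, hba]) (by simp [R.rel₃, hac]) hj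
    (fun w hw => hp _ (mem_sup_right ⟨w, hw, rfl⟩))
  refine hR.nice_of_side (by omega) (by omega) (by omega) (.single hξ) (.single hξ)
    ⟨?_, ?_⟩ ⟨?_, ?_⟩ s₁ s₄
  · simpa [Fin.forall_fin_one, hac] using SignComb.zero _
  · intro v _; simp [hba]
  · exact Fin.forall_fin_one.2 (SignComb.self ![R.b₂ c] 0)
  · intro v hv; simpa using hv

/-- A summand supported on the first two vertices. -/
theorem Indec.nice_of_mem_ker (hR : R.Indec) {x : R.V₂} {i : ℕ} (hx : R.a₂ x = 0)
    (hi : x ∈ R.flag₂ (i + 1)) (hc : x ∉ LinearMap.range R.b₂ ⊔ R.flag₂ i) : R.Nice := by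
  obtain ⟨ξ, hξ, hp⟩ := exists_functional hc
  have hb : ∀ v, ξ (R.b₂ v) = 0 := fun v => hp _ (mem_sup_left ⟨v, rfl⟩)
  have s₁ : Side R.a₁ R.b₁ ![x] ![ξ] := side_single R.rel₁ hξ (by simp [R.rel₂, hb])
    (by simp [R.rel₂, hx]) hi (fun w hw => hp _ (mem_sup_right hw))
  refine hR.nice_of_side (by omega) (by omega) (by omega) (.single hξ) (.empty ![] ![])
    ⟨?_, ?_⟩ ⟨?_, ?_⟩ s₁ (side_empty _ _)
  · simpa [Fin.forall_fin_one, hx] using SignComb.zero _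
  · intro _ _ i; exact i.elim0
  · intro i; exact i.elim0
  · intro v _; simp [hb]

/-- A summand with two vectors at the third vertex and one at the second. -/
theorem Indec.nice_of_mem_range (hR : R.Indec) {c : R.V₃} {i : ℕ}
    (haba : ∀ v, R.a₂ (R.b₂ (R.a₂ v)) = 0) (hac : R.b₂ (R.a₂ (R.b₂ c)) = 0)
    (hi : R.b₂ c ∈ R.flag₂ (i + 1)) (hc : R.b₂ c ∉ LinearMap.ker R.a₂ ⊔ R.flag₂ i) :
    R.Nice := by
  obtain ⟨ξ, hξ, hp⟩ := exists_functional hc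
  -- As `ξ` kills the kernel of `a₂`, it comes from a functional at the third vertex, which then
  -- pairs to 1 with `a₂ (b₂ c)`.
  obtain ⟨θ, hθ⟩ := exists_factor R.a₂ ξ fun v hv => hp _ (mem_sup_left hv)
  have hba : ∀ v, ξ (R.b₂ (R.a₂ v)) = 0 := fun v => by rw [← hθ, haba, map_zero]
  have s₁ : Side R.a₁ R.b₁ ![R.b₂ c] ![ξ] := side_single R.rel₁ hξ (by simp [R.rel₂, hba])
    (by simp [R.rel₂, hac]) hi (fun w hw => hp _ (mem_sup_right hw))
  have s₄ := side_full (a := R.b₃) (b := R.a₃) R.rel₄ (x := c) (θ := θ)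
    (by simpa [R.rel₃, hθ] using hξ)
  refine hR.nice_of_side (by omega) (by omega) (by omega) (.single hξ) ?_
    ⟨?_, ?_⟩ ⟨?_, ?_⟩ s₁ s₄
  · exact .pair (by simpa [R.rel₃, hθ] using hξ) (by simpa [R.rel₃, hθ] using hξ)
      (.inl (by simp [R.rel₃, haba]))
  · refine Fin.forall_fin_one.2 ?_
    have := SignComb.self ![c, R.b₃ (R.a₃ c)] 1
    simpa [R.rel₃] using this
  · intro v hv
    exact Fin.forall_fin_two.2 ⟨by simp [R.rel₃, haba], by simpa [hθ] using hv⟩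
  · refine Fin.forall_fin_two.2 ⟨SignComb.self ![R.b₂ c] 0, ?_⟩
    simpa [R.rel₃, hac] using SignComb.zero _
  · intro v hv
    have := hv 0
    simpa [R.rel₃, hθ] using this

/-- A summand with two vectors at each of the two middle vertices and an outer vertex attached
diagonally. -/
theorem Indec.nice_of_diag (hR : R.Indec) {x : R.V₂} {c : R.V₃} {i j : ℕ}
    (haba : ∀ v, R.a₂ (R.b₂ (R.a₂ v)) = 0) (hij : i < j) (hj : j ≤ 2)
    (hx : R.a₂ x = 0) (hxj : x ∈ R.flag₂ (j + 1)) (hac : R.b₂ (R.a₂ (R.b₂ c)) = 0)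
    (hi : x + R.b₂ c ∈ R.flag₂ (i + 1))
    (hc : ∀ b, ∀ k, ∀ f ∈ R.flag₂ i, R.a₂ k = 0 → k ∈ R.flag₂ j → x ≠ R.b₂ b + f + k) :
    R.Nice := by
  obtain ⟨ξ, ζ, hξ, hξb, hζa, hξζ, hξi⟩ := exists_functional_pair
    (B := LinearMap.range R.b₂) (K := LinearMap.ker R.a₂) (F := R.flag₂ j) (F₀ := R.flag₂ i)
    (x := x) (by rintro _ ⟨b, rfl⟩ k hk f hf hkj; exact hc b k f hf hk hkj)
  have hζx : ζ x = 0 := hζa _ hx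
  have hξb : ∀ v, ξ (R.b₂ v) = 0 := fun v => hξb _ ⟨v, rfl⟩
  have hz : ζ (R.b₂ c) = 1 := by
    -- Because i < j, the vector `x + b₂ c` lies where `ξ` and `ζ` agree; `ξ` sees only `x` there
    -- and `ζ` only `b₂ c`.
    have h := hξζ (x + R.b₂ c) (monotone_nat_of_le_succ flag₂_mono (by omega : i + 1 ≤ j) hi)
    simpa [hξ, hζx, hξb] using h.symm
  obtain ⟨θ, hθ⟩ := exists_factor R.a₂ ζ hζa
  have s₁ : Side R.a₁ R.b₁ ![x, R.b₂ c] ![ξ, ζ] := side_diag R.rel₁ hξ (hξb c) hζx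
    (by simp [R.rel₂, hξb]) (by simp [R.rel₂, hx]) hij hj hi hxj hξi hξζ
  have s₄ := side_full (a := R.b₃) (b := R.a₃) R.rel₄ (x := c) (θ := θ)
    (by simpa [R.rel₃, hθ] using hz)
  refine hR.nice_of_side (by omega) (by omega) (by omega) (.pair hξ hz (.inl (hξb c))) ?_
    ⟨?_, ?_⟩ ⟨?_, ?_⟩ s₁ s₄
  · exact .pair (by simpa [R.rel₃, hθ] using hz) (by simpa [R.rel₃, hθ] using hz)
      (.inl (by simp [R.rel₃, haba]))
  · refine Fin.forall_fin_two.2 ⟨?_, ?_⟩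
    · simpa [hx] using SignComb.zero _
    · have := SignComb.self ![c, R.b₃ (R.a₃ c)] 1
      simpa [R.rel₃] using this
  · intro v hv
    have := hv 1
    exact Fin.forall_fin_two.2 ⟨by simp [R.rel₃, haba], by simpa [hθ] using this⟩
  · refine Fin.forall_fin_two.2 ⟨SignComb.self ![x, R.b₂ c] 1, ?_⟩
    simpa [R.rel₃, hac] using SignComb.zero _
  · intro v hv
    have h0 := hv 0
    refine Fin.forall_fin_two.2 ⟨by simp [hξb], ?_⟩
    simpa [R.rel₃, hθ] using h0

/-! ### Exhaustion: a representation without candidate summands has zero middle spaces -/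

section Exhaustion

theorem aba_eq_zero (hR : R.Indec) (hN : ¬ R.Nice) (v : R.V₂) : R.a₂ (R.b₂ (R.a₂ v)) = 0 := by
  by_contra h
  exact hN (hR.nice_of_length_four h)

theorem bab_eq_zero (hR : R.Indec) (hN : ¬ R.Nice) (v : R.V₃) : R.b₂ (R.a₂ (R.b₂ v)) = 0 :=
  aba_eq_zero hR.flip (fun h => hN (.of_flip h)) v

/-- Take a counterexample with `b₂ c` as low as possible in the flag of `V₂` and then `c` as low as
possible in that of `V₃`. Excluding `nice_of_string` writes `b₂ c` as a sum of lower terms, each of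
which lies in im(ba) by minimality. -/
theorem exists_eq_ba (hR : R.Indec) (hN : ¬ R.Nice) {c : R.V₃} (hc : R.a₂ (R.b₂ c) = 0) :
    ∃ w, R.b₂ c = R.b₂ (R.a₂ w) := by
  classical
  by_contra hcR
  have hex : ∃ i, ∃ c, R.a₂ (R.b₂ c) = 0 ∧ R.b₂ c ∈ R.flag₂ i ∧
      ¬ ∃ w, R.b₂ c = R.b₂ (R.a₂ w) := ⟨3, c, hc, trivial, hcR⟩
  obtain ⟨c₁, hc₁, hm₁, hr₁⟩ := Nat.find_spec hex
  have hmin := @Nat.find_min _ _ hex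
  match hi : Nat.find hex with
  | 0 =>
    rw [hi] at hm₁
    exact hr₁ ⟨0, by rw [(Submodule.mem_bot ℂ).1 hm₁]; simp⟩
  | i + 1 =>
    rw [hi] at hm₁ hmin
    have hex' : ∃ j, ∃ c, R.a₂ (R.b₂ c) = 0 ∧ R.b₂ c ∈ R.flag₂ (i + 1) ∧ c ∈ R.flag₃ j ∧
      ¬ ∃ w, R.b₂ c = R.b₂ (R.a₂ w) := ⟨3, c₁, hc₁, hm₁, trivial, hr₁⟩
    obtain ⟨c₂, hc₂, hm₂, hj₂, hr₂⟩ := Nat.find_spec hex'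
    have hmin' := @Nat.find_min _ _ hex'
    -- Bounding the level by 3 puts the preceding step of the flag inside the kernel of `a₃`, on
    -- which ab = `b₃ a₃` vanishes.
    have hle : Nat.find hex' ≤ 3 := Nat.find_min' hex' ⟨c₁, hc₁, hm₁, trivial, hr₁⟩
    match hj : Nat.find hex' with
    | 0 =>
      rw [hj] at hj₂
      exact hr₂ ⟨0, by rw [(Submodule.mem_bot ℂ).1 hj₂]; simp⟩
    | j + 1 =>
      rw [hj] at hj₂ hmin' hle
      refine hN (hR.nice_of_string hc₂ hm₂ hj₂ fun hmem => hr₂ ?_)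
      simp only [Submodule.mem_sup] at hmem
      obtain ⟨_, ⟨_, ⟨w, rfl⟩, f, hf, rfl⟩, _, ⟨g, hg, rfl⟩, h⟩ := hmem
      have h : R.b₂ (R.a₂ w) + f + R.b₂ g = R.b₂ c₂ := h
      have hag : R.a₂ (R.b₂ g) = 0 := by
        have : g ∈ R.flag₃ 2 := monotone_nat_of_le_succ (flag₂_mono (R := R.flip))
          (by omega : j ≤ 2) hg
        have : R.a₃ g = 0 := this
        rw [← R.rel₃, this, map_zero]
      -- The remainder is itself in the image of b, hence a candidate at the lower level i.
      have hf' : f = R.b₂ (c₂ - R.a₂ w - g) := by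
        simp only [map_sub, ← h]; abel
      obtain ⟨w', hw'⟩ : ∃ w', f = R.b₂ (R.a₂ w') := by
        by_contra hfr
        refine hmin (Nat.lt_succ_self i) ⟨_, ?_, hf' ▸ hf, by rwa [← hf']⟩
        simp [hc₂, hag, aba_eq_zero hR hN]
      -- Subtracting elements of im(ba) = im(`a₁ b₁`) keeps the level in `V₂`, so minimality in `V₃`
      -- applies to `g`.
      have hba : ∀ v, R.b₂ (R.a₂ v) ∈ R.flag₂ (i + 1) := fun v =>
        monotone_nat_of_le_succ flag₂_mono (by omega : 1 ≤ i + 1) ⟨R.b₁ v, R.rel₂ v⟩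
      obtain ⟨w'', hw''⟩ : ∃ w', R.b₂ g = R.b₂ (R.a₂ w') := by
        by_contra hgr
        refine hmin' (Nat.lt_succ_self j) ⟨g, hag, ?_, hg, hgr⟩
        have : R.b₂ g = R.b₂ c₂ - R.b₂ (R.a₂ (w + w')) := by
          rw [← h, hw']; simp only [map_add]; abel
        rw [this]
        exact sub_mem hm₂ (hba _)
      exact ⟨w + w' + w'', by rw [← h, hw', hw'']; simp only [map_add]⟩

/-- It suffices that ker a and im b both lie in im(ba), since av = abw for some w by the flipped
`exists_eq_ba`. These inclusions concern two subspaces, K = ker a and B = im b, against the flag 0 =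
F₀ ≤ F₁ ≤ F₂ ≤ F₃ of `V₂`. Excluded summands allow elements of K or B, or diagonal combinations of
the two, to be moved down the flag, and K ∩ B ⊆ im(ba) ends the descent. -/
theorem exists_eq_ba_of_ba_eq_zero (hR : R.Indec) (hN : ¬ R.Nice) {v : R.V₂}
    (hv : R.b₂ (R.a₂ v) = 0) : ∃ w, v = R.b₂ (R.a₂ w) := by
  have haba := aba_eq_zero hR hN
  have hbab := bab_eq_zero hR hN
  have hX : ∀ x c, R.a₂ x = 0 → x = R.b₂ c → ∃ w, x = R.b₂ (R.a₂ w) := by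
    rintro x c hx rfl
    exact exists_eq_ba hR hN hx
  have hY : ∀ x i, R.a₂ x = 0 → x ∈ R.flag₂ (i + 1) → ∃ c, ∃ f ∈ R.flag₂ i, x = R.b₂ c + f := by
    intro x i hx hi
    by_contra h
    refine hN (hR.nice_of_mem_ker hx hi fun hm => h ?_)
    obtain ⟨_, ⟨c, rfl⟩, f, hf, rfl⟩ := Submodule.mem_sup.1 hm
    exact ⟨c, f, hf, rfl⟩
  have hZ : ∀ c i, R.b₂ c ∈ R.flag₂ (i + 1) →
      ∃ k, R.a₂ k = 0 ∧ ∃ f ∈ R.flag₂ i, R.b₂ c = k + f := by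
    intro c i hi
    by_contra h
    refine hN (hR.nice_of_mem_range haba (hbab c) hi fun hm => h ?_)
    obtain ⟨k, hk, f, hf, hkf⟩ := Submodule.mem_sup.1 hm
    exact ⟨k, hk, f, hf, hkf.symm⟩
  have hD : ∀ x c i j, i < j → j ≤ 2 → R.a₂ x = 0 → x ∈ R.flag₂ (j + 1) →
      x + R.b₂ c ∈ R.flag₂ (i + 1) →
      ∃ b, ∃ k, R.a₂ k = 0 ∧ k ∈ R.flag₂ j ∧ ∃ f ∈ R.flag₂ i, x = R.b₂ b + f + k := by
    intro x c i j hij hj hx hxj hi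
    by_contra h
    exact hN (hR.nice_of_diag haba hij hj hx hxj (hbab c) hi fun b k f hf hk hkj he =>
      h ⟨b, k, hk, hkj, f, hf, he⟩)
  -- In the climb that follows, `yⱼ` treats K ∩ Fⱼ, `dᵢⱼ` treats K ∩ Fⱼ ∩ (B + Fᵢ), and `zⱼ` treats
  -- B ∩ Fⱼ. Each rests only on cases already settled.
  have y₁ : ∀ x, R.a₂ x = 0 → x ∈ R.flag₂ 1 → ∃ w, x = R.b₂ (R.a₂ w) := by
    intro x hx h1
    obtain ⟨c, f, hf, h⟩ := hY x 0 hx h1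
    rw [(Submodule.mem_bot ℂ).1 hf, add_zero] at h
    exact hX x c hx h
  have d₁₂ : ∀ x c, R.a₂ x = 0 → x ∈ R.flag₂ 2 → x + R.b₂ c ∈ R.flag₂ 1 →
      ∃ w, x = R.b₂ (R.a₂ w) := by
    intro x c hx h2 h1
    obtain ⟨b, k, hk, hk1, f, hf, h⟩ := hD x c 0 1 (by omega) (by omega) hx h2 h1
    obtain ⟨w, rfl⟩ := y₁ k hk hk1
    rw [(Submodule.mem_bot ℂ).1 hf, add_zero, ← map_add] at h
    exact hX x _ hx h
  have y₂ : ∀ x, R.a₂ x = 0 → x ∈ R.flag₂ 2 → ∃ w, x = R.b₂ (R.a₂ w) := by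
    intro x hx h2
    obtain ⟨c, f, hf, h⟩ := hY x 1 hx h2
    refine d₁₂ x (-c) hx h2 ?_
    rwa [map_neg, h, add_neg_cancel_comm]
  have d₁₃ : ∀ x c, R.a₂ x = 0 → x + R.b₂ c ∈ R.flag₂ 1 → ∃ w, x = R.b₂ (R.a₂ w) := by
    intro x c hx h1
    obtain ⟨b, k, hk, hk1, f, hf, h⟩ := hD x c 0 2 (by omega) (by omega) hx trivial h1
    obtain ⟨w, rfl⟩ := y₂ k hk hk1
    rw [(Submodule.mem_bot ℂ).1 hf, add_zero, ← map_add] at h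
    exact hX x _ hx h
  have d₂₃ : ∀ x c, R.a₂ x = 0 → x + R.b₂ c ∈ R.flag₂ 2 → ∃ w, x = R.b₂ (R.a₂ w) := by
    intro x c hx h2
    obtain ⟨b, k, hk, hk2, f, hf, h⟩ := hD x c 1 2 (by omega) (by omega) hx trivial h2
    obtain ⟨w, rfl⟩ := y₂ k hk hk2
    -- Removing the part of `x` in B leaves `f`, which is in F₁.
    refine d₁₃ x (-(b + R.a₂ w)) hx ?_
    convert hf using 1
    rw [h, map_neg, map_add]
    abel
  have z₂ : ∀ c, R.b₂ c ∈ R.flag₂ 2 → ∃ w, R.b₂ c = R.b₂ (R.a₂ w) := by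
    intro c h2
    obtain ⟨k, hk, f, hf, h⟩ := hZ c 1 h2
    -- `k` differs from `b₂ c` by an element of F₁, so the diagonal case covers it; what remains of
    -- `b₂ c` lies in B ∩ F₁.
    obtain ⟨w, rfl⟩ := d₁₃ k (-c) hk (by rw [map_neg, h]; simpa using hf)
    have hf' : R.b₂ (c - R.a₂ w) = f := by rw [map_sub, h]; abel
    obtain ⟨k', hk', f', hf0, h'⟩ := hZ (c - R.a₂ w) 0 (hf' ▸ hf)
    rw [(Submodule.mem_bot ℂ).1 hf0, add_zero] at h'
    obtain ⟨w', hw'⟩ := hX k' _ hk' h'.symm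
    exact ⟨w + w', by rw [h, ← hf', h', hw', map_add, map_add]⟩
  have y₃ : ∀ x, R.a₂ x = 0 → ∃ w, x = R.b₂ (R.a₂ w) := by
    intro x hx
    obtain ⟨c, f, hf, h⟩ := hY x 2 hx trivial
    refine d₂₃ x (-c) hx ?_
    rwa [map_neg, h, add_neg_cancel_comm]
  have z₃ : ∀ c, ∃ w, R.b₂ c = R.b₂ (R.a₂ w) := by
    intro c
    obtain ⟨k, hk, f, hf, h⟩ := hZ c 2 trivial
    obtain ⟨w, rfl⟩ := y₃ k hk
    have hf' : R.b₂ (c - R.a₂ w) = f := by rw [map_sub, h]; abel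
    obtain ⟨w', hw'⟩ := z₂ (c - R.a₂ w) (hf' ▸ hf)
    exact ⟨w + w', by rw [h, ← hf', hw', map_add, map_add]⟩
  obtain ⟨w, hw⟩ : ∃ w, R.a₂ v = R.a₂ (R.b₂ w) :=
    exists_eq_ba hR.flip (fun h => hN (.of_flip h)) hv
  obtain ⟨w', hw'⟩ := y₃ (v - R.b₂ w) (by rw [map_sub, hw, sub_self])
  obtain ⟨w'', hw''⟩ := z₃ w
  exact ⟨w' + w'', by rw [map_add, map_add, ← hw', ← hw'']; abel⟩

/-- If ker(ba) ⊆ im(ba), then aba = 0 makes a vanish on ker(ba); symmetrically b vanishes on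
ker(ab). From bab = 0 this gives ab = 0, then b = 0, and likewise a = 0. Then ker(ba) ⊆ im(ba) = 0
empties `V₂`, and similarly `V₃`. -/
theorem Indec.nice (hR : R.Indec)
    (h : (∃ x : R.V₁, x ≠ 0) ∨ (∃ x : R.V₂, x ≠ 0) ∨ (∃ x : R.V₃, x ≠ 0) ∨ ∃ x : R.V₄, x ≠ 0) :
    R.Nice := by
  by_contra hN
  have hN' : ¬ R.flip.Nice := fun h => hN (.of_flip h)
  have haba := aba_eq_zero hR hN
  have hbab := bab_eq_zero hR hN
  have h2 : ∀ v, R.b₂ (R.a₂ v) = 0 → R.a₂ v = 0 := fun v hv => by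
    obtain ⟨w, rfl⟩ := exists_eq_ba_of_ba_eq_zero hR hN hv
    exact haba w
  have h3 : ∀ v, R.a₂ (R.b₂ v) = 0 → R.b₂ v = 0 := fun v hv => by
    obtain ⟨w, rfl⟩ : ∃ w, v = R.a₂ (R.b₂ w) := exists_eq_ba_of_ba_eq_zero hR.flip hN' hv
    exact hbab w
  have hb : ∀ v, R.b₂ v = 0 := fun v => h3 v (h2 _ (hbab v))
  have ha : ∀ v, R.a₂ v = 0 := fun v => h2 v (h3 _ (haba v))
  have v2 : ∀ v : R.V₂, v = 0 := fun v => by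
    obtain ⟨w, rfl⟩ := exists_eq_ba_of_ba_eq_zero hR hN (hb (R.a₂ v))
    exact hb _
  have v3 : ∀ v : R.V₃, v = 0 := fun v => by
    obtain ⟨w, rfl⟩ : ∃ w, v = R.a₂ (R.b₂ w) :=
      exists_eq_ba_of_ba_eq_zero hR.flip hN' (ha (R.b₂ v))
    exact ha _
  rcases h with ⟨x, hx⟩ | ⟨x, hx⟩ | ⟨x, hx⟩ | ⟨x, hx⟩
  · exact hN (hR.nice_of_subsingleton v2 hx)
  · exact hx (v2 x)
  · exact hx (v3 x)
  · exact hN' (hR.flip.nice_of_subsingleton v3 hx)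

end Exhaustion

end Rep4

/-! ### Weight spaces of modules and confinement to four weights -/

namespace E2Mod

theorem lie_eq (V : E2Mod.{u}) (x : E2) (v : V.carrier) :
    ⁅x, v⁆ = x 0 • ⁅E2.pPlus, v⁆ + x 1 • ⁅E2.pMinus, v⁆ + x 2 • ⁅E2.l, v⁆ := by
  have hx : x = x 0 • E2.pPlus + x 1 • E2.pMinus + x 2 • E2.l := by
    ext i
    fin_cases i <;> simp [E2.pPlus, E2.pMinus, E2.l, E2.basis_apply]
  conv_lhs => rw [hx]
  simp only [add_lie, smul_lie]

variable {V : E2Mod.{u}}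

theorem pPlus_lie_mem {k k' : ℤ} (h : k' = k + 1) {v : V.carrier}
    (hv : v ∈ weightSpace V.carrier k) : ⁅E2.pPlus, v⁆ ∈ weightSpace V.carrier k' := by
  rw [mem_weightSpace] at hv ⊢
  rw [leibniz_lie, E2.lie_l_pPlus, hv, lie_smul, h]
  push_cast
  module

theorem pMinus_lie_mem {k k' : ℤ} (h : k = k' + 1) {v : V.carrier}
    (hv : v ∈ weightSpace V.carrier k) : ⁅E2.pMinus, v⁆ ∈ weightSpace V.carrier k' := by
  rw [mem_weightSpace] at hv ⊢
  rw [leibniz_lie, E2.lie_l_pMinus, hv, lie_smul, neg_lie, h]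
  push_cast
  module

theorem pPlus_lie_pMinus_lie (v : V.carrier) :
    ⁅E2.pPlus, ⁅E2.pMinus, v⁆⁆ = ⁅E2.pMinus, ⁅E2.pPlus, v⁆⁆ := by
  rw [leibniz_lie, E2.lie_pPlus_pMinus, zero_lie, zero_add]

theorem iSupIndep_weightSpace (V : E2Mod.{u}) :
    iSupIndep fun k : ℤ => weightSpace V.carrier k :=
  (Module.End.eigenspaces_iSupIndep (LieModule.toEnd ℂ E2 V.carrier E2.l)).comp
    (f := fun k : ℤ => (k : ℂ)) Int.cast_injective

theorem Indecomposable.eq_bot_or_eq_bot (hV : V.Indecomposable) {S T : Submodule ℂ V.carrier}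
    (hS : ∀ v ∈ S, ⁅E2.pPlus, v⁆ ∈ S ∧ ⁅E2.pMinus, v⁆ ∈ S ∧ ⁅E2.l, v⁆ ∈ S)
    (hT : ∀ v ∈ T, ⁅E2.pPlus, v⁆ ∈ T ∧ ⁅E2.pMinus, v⁆ ∈ T ∧ ⁅E2.l, v⁆ ∈ T)
    (h : IsCompl S T) : S = ⊥ ∨ T = ⊥ := by
  have key : ∀ {S : Submodule ℂ V.carrier},
      (∀ v ∈ S, ⁅E2.pPlus, v⁆ ∈ S ∧ ⁅E2.pMinus, v⁆ ∈ S ∧ ⁅E2.l, v⁆ ∈ S) →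
      ∀ {x : E2} {v : V.carrier}, v ∈ S → ⁅x, v⁆ ∈ S := by
    intro S hS x v hv
    obtain ⟨h1, h2, h3⟩ := hS v hv
    rw [lie_eq]
    exact add_mem (add_mem (S.smul_mem _ h1) (S.smul_mem _ h2)) (S.smul_mem _ h3)
  have := hV.2 { S with lie_mem := key hS } { T with lie_mem := key hT }
    (LieSubmodule.isCompl_toSubmodule.1 h)
  simpa only [← LieSubmodule.toSubmodule_eq_bot] using this

/-- The weight spaces inside `s` and those outside sum to complementary subspaces. Both are
submodules, because any step of `p₊` or `p₋` across the boundary of `s` starts or ends in a zero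
weight space. -/
theorem Indecomposable.weightSpace_eq_bot (hV : V.Indecomposable) {s : Set ℤ}
    (h : ∀ k, ¬ (k ∈ s ↔ k + 1 ∈ s) →
      weightSpace V.carrier k = ⊥ ∨ weightSpace V.carrier (k + 1) = ⊥)
    {k : ℤ} (hk : k ∈ s) (hkV : weightSpace V.carrier k ≠ ⊥) :
    ∀ k', k' ∉ s → weightSpace V.carrier k' = ⊥ := by
  have key : ∀ s : Set ℤ, (∀ k, ¬ (k ∈ s ↔ k + 1 ∈ s) →
      weightSpace V.carrier k = ⊥ ∨ weightSpace V.carrier (k + 1) = ⊥) →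
      ∀ v ∈ ⨆ k ∈ s, weightSpace V.carrier k,
        ⁅E2.pPlus, v⁆ ∈ ⨆ k ∈ s, weightSpace V.carrier k ∧
        ⁅E2.pMinus, v⁆ ∈ ⨆ k ∈ s, weightSpace V.carrier k ∧
        ⁅E2.l, v⁆ ∈ ⨆ k ∈ s, weightSpace V.carrier k := by
    intro s h
    have hle : ∀ k ∈ s, weightSpace V.carrier k ≤ ⨆ k ∈ s, weightSpace V.carrier k :=
      fun k hk => le_biSup (fun k => weightSpace V.carrier k) hk
    set S := ⨆ k ∈ s, weightSpace V.carrier k with hS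
    have hm : ∀ f : V.carrier →ₗ[ℂ] V.carrier,
        (∀ k ∈ s, ∀ v ∈ weightSpace V.carrier k, f v ∈ S) → ∀ v ∈ S, f v ∈ S := by
      intro f hf
      have : S ≤ S.comap f := iSup₂_le fun k hk v hv => hf k hk v hv
      exact this
    intro v hv
    refine ⟨hm (LieModule.toEnd ℂ E2 V.carrier E2.pPlus) ?_ v hv,
      hm (LieModule.toEnd ℂ E2 V.carrier E2.pMinus) ?_ v hv,
      hm (LieModule.toEnd ℂ E2 V.carrier E2.l) ?_ v hv⟩
    · intro k hk v hv
      have := pPlus_lie_mem rfl hv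
      by_cases hk' : k + 1 ∈ s
      · exact hle _ hk' this
      · rw [LieModule.toEnd_apply_apply]
        rcases h k (by tauto) with h | h
        · rw [h, Submodule.mem_bot] at hv
          rw [hv, lie_zero]
          exact zero_mem _
        · rw [h, Submodule.mem_bot] at this
          rw [this]
          exact zero_mem _
    · intro k hk v hv
      have := pMinus_lie_mem (k' := k - 1) (by ring) hv
      by_cases hk' : k - 1 ∈ s
      · exact hle _ hk' this
      · rw [LieModule.toEnd_apply_apply]
        have h := h (k - 1) (by rw [sub_add_cancel]; tauto)
        rw [sub_add_cancel] at h
        rcases h with h | h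
        · rw [h, Submodule.mem_bot] at this
          rw [this]
          exact zero_mem _
        · rw [h, Submodule.mem_bot] at hv
          rw [hv, lie_zero]
          exact zero_mem _
    · intro k hk v hv
      rw [LieModule.toEnd_apply_apply, mem_weightSpace.1 hv]
      exact smul_mem _ _ (hle k hk hv)
  have hc : IsCompl (⨆ k ∈ s, weightSpace V.carrier k) (⨆ k ∈ sᶜ, weightSpace V.carrier k) := by
    refine ⟨V.iSupIndep_weightSpace.disjoint_biSup_biSup disjoint_compl_right, ?_⟩
    rw [codisjoint_iff, eq_top_iff, ← V.iSup_weightSpace]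
    refine iSup_le fun k => ?_
    by_cases hk : k ∈ s
    · exact le_sup_of_le_left (le_biSup (fun k => weightSpace V.carrier k) hk)
    · exact le_sup_of_le_right (le_biSup (fun k => weightSpace V.carrier k) (Set.mem_compl hk))
  rcases hV.eq_bot_or_eq_bot (key s h)
    (key sᶜ fun k hk => h k (by simpa only [Set.mem_compl_iff, not_iff_not] using hk)) hc with h | h
  · refine absurd (eq_bot_iff.2 ?_) hkV
    rw [← h]
    exact le_biSup (fun k => weightSpace V.carrier k) hk
  · intro k' hk'
    rw [eq_bot_iff, ← h]
    exact le_biSup (fun k => weightSpace V.carrier k) (Set.mem_compl hk')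

theorem Indecomposable.exists_weightSpace_ne_bot (hV : V.Indecomposable) :
    ∃ k, weightSpace V.carrier k ≠ ⊥ := by
  by_contra! h
  have := hV.1
  have h' := V.iSup_weightSpace
  simp only [h, iSup_const] at h'
  simp at h'

theorem Indecomposable.exists_interval (hV : V.Indecomposable) {A : Finset ℤ}
    (hA : ∀ a : ℤ, ¬ Finset.Icc a (a + 4) ⊆ A) (hVA : V.SupportedOn (A : Set ℤ)) :
    ∃ m : ℤ, ∀ k, k ∉ Set.Icc m (m + 3) → weightSpace V.carrier k = ⊥ := by
  obtain ⟨k, hk⟩ := hV.exists_weightSpace_ne_bot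
  have hkA : k ∈ A := by
    by_contra h
    exact hk (hVA k (by simpa using h))
  have hex₁ : ∃ i : ℕ, k - i ∉ A := by
    by_contra! h
    refine hA (k - 4) fun a ha => ?_
    rw [Finset.mem_Icc] at ha
    have := h (k - a).toNat
    rwa [Int.toNat_of_nonneg (by omega), sub_sub_cancel] at this
  have hex₂ : ∃ i : ℕ, k + i ∉ A := by
    by_contra! h
    refine hA k fun a ha => ?_
    rw [Finset.mem_Icc] at ha
    have := h (a - k).toNat
    rwa [Int.toNat_of_nonneg (by omega), add_sub_cancel] at this
  classical
  have hi := Nat.find_spec hex₁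
  have hj := Nat.find_spec hex₂
  have hi' := @Nat.find_min _ _ hex₁
  have hj' := @Nat.find_min _ _ hex₂
  set i := Nat.find hex₁
  set j := Nat.find hex₂
  have hrun : ∀ a, k - i < a → a < k + j → a ∈ A := by
    intro a h₁ h₂
    rcases le_total a k with h | h
    · have := hi' (m := (k - a).toNat) (by omega)
      rwa [Int.toNat_of_nonneg (by omega), sub_sub_cancel, not_not] at this
    · have := hj' (m := (a - k).toNat) (by omega)
      rwa [Int.toNat_of_nonneg (by omega), add_sub_cancel, not_not] at this
  -- The nearest points outside `A` on either side of `k` enclose at most four integers, as five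
  -- would be a forbidden run.
  have hlen : k + j ≤ k - i + 5 := by
    by_contra! h
    refine hA (k - i + 1) fun a ha => ?_
    rw [Finset.mem_Icc] at ha
    exact hrun a (by omega) (by omega)
  have hi0 : 0 < i := by
    rcases Nat.eq_zero_or_pos i with h | h
    · rw [h] at hi; simp [hkA] at hi
    · exact h
  have hj0 : 0 < j := by
    rcases Nat.eq_zero_or_pos j with h | h
    · rw [h] at hj; simp [hkA] at hj
    · exact h
  have hbi := hVA (k - i) (by simpa using hi)
  have hbj := hVA (k + j) (by simpa using hj)
  have := hV.weightSpace_eq_bot (s := Set.Ioo (k - i) (k + j)) (k := k) ?_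
    ⟨by omega, by omega⟩ hk
  · refine ⟨k - i + 1, fun k' hk' => this k' fun h => hk' ?_⟩
    rw [Set.mem_Ioo] at h
    exact ⟨by omega, by omega⟩
  · intro a ha
    simp only [Set.mem_Ioo] at ha
    obtain h | h | h | h : a = k - i ∨ a + 1 = k - i ∨ a = k + j ∨ a + 1 = k + j := by omega
    all_goals rw [h]; tauto

/-! ### Modules given by sign matrices -/

/-- The data of a basis of weight vectors on which `p₊` and `p₋` act by matrices with entries in
`{-1, 0, 1}`. -/
def HasSignBasis (V : E2Mod.{u}) {ι : Type} [Fintype ι] (w : ι → ℤ) (p q : ι → ι → SignType) :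
    Prop :=
  ∃ e : Basis ι ℂ V.carrier, (∀ j, ⁅E2.l, e j⁆ = (w j : ℂ) • e j) ∧
    (∀ j, ⁅E2.pPlus, e j⁆ = ∑ i, ((p j i : SignType) : ℂ) • e i) ∧
    (∀ j, ⁅E2.pMinus, e j⁆ = ∑ i, ((q j i : SignType) : ℂ) • e i)

theorem HasSignBasis.isoClass_eq {W : E2Mod.{u}} {ι : Type} [Fintype ι] {w : ι → ℤ}
    {p q : ι → ι → SignType} (hV : V.HasSignBasis w p q) (hW : W.HasSignBasis w p q) :
    V.isoClass = W.isoClass := by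
  obtain ⟨e, hl, hp, hq⟩ := hV
  obtain ⟨e', hl', hp', hq'⟩ := hW
  let f : V.carrier ≃ₗ[ℂ] W.carrier := e.equiv e' (Equiv.refl ι)
  have hf : ∀ i, f (e i) = e' i := fun i => by simp [f]
  have key : ∀ (x : E2), (∀ j, f ⁅x, e j⁆ = ⁅x, e' j⁆) → ∀ v, f ⁅x, v⁆ = ⁅x, f v⁆ := by
    intro x h v
    have : f.toLinearMap ∘ₗ LieModule.toEnd ℂ E2 V.carrier x =
        LieModule.toEnd ℂ E2 W.carrier x ∘ₗ f.toLinearMap :=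
      e.ext fun j => by simpa [hf] using h j
    exact LinearMap.congr_fun this v
  have h1 := key E2.pPlus fun j => by simp [hp, hp', hf]
  have h2 := key E2.pMinus fun j => by simp [hq, hq', hf]
  have h3 := key E2.l fun j => by simp [hl, hl', hf]
  refine Quotient.sound ⟨?_⟩
  exact
    { f with
      map_lie' := by
        intro x v
        change f ⁅x, v⁆ = ⁅x, f v⁆
        rw [lie_eq, lie_eq W]
        simp only [map_add, map_smul, h1, h2, h3]
      invFun := f.symm
      left_inv := f.left_inv
      right_inv := f.right_inv }

theorem HasSignBasis.reindex {ι κ : Type} [Fintype ι] [Fintype κ] (g : ι ≃ κ) {w : ι → ℤ}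
    {p q : ι → ι → SignType} (hV : V.HasSignBasis w p q) :
    V.HasSignBasis (w ∘ g.symm) (fun i j => p (g.symm i) (g.symm j))
      (fun i j => q (g.symm i) (g.symm j)) := by
  obtain ⟨e, hl, hp, hq⟩ := hV
  refine ⟨e.reindex g, fun j => by simp [hl], fun j => ?_, fun j => ?_⟩
  · rw [Basis.reindex_apply, hp, ← g.symm.sum_comp]
    simp
  · rw [Basis.reindex_apply, hq, ← g.symm.sum_comp]
    simp

/-! ### From modules on four weights to representations of type A₄ -/

section Rep

variable (V)

/-- The action of `p₊` as a map between consecutive weight spaces. -/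
noncomputable def raise {k k' : ℤ} (h : k' = k + 1) :
    weightSpace V.carrier k →ₗ[ℂ] weightSpace V.carrier k' :=
  (LieModule.toEnd ℂ E2 V.carrier E2.pPlus).restrict fun _ hv => pPlus_lie_mem h hv

/-- The action of `p₋` as a map between consecutive weight spaces. -/
noncomputable def lower {k k' : ℤ} (h : k = k' + 1) :
    weightSpace V.carrier k →ₗ[ℂ] weightSpace V.carrier k' :=
  (LieModule.toEnd ℂ E2 V.carrier E2.pMinus).restrict fun _ hv => pMinus_lie_mem h hv

variable {V}

@[simp] theorem coe_raise {k k' : ℤ} (h : k' = k + 1) (v : weightSpace V.carrier k) :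
    (V.raise h v : V.carrier) = ⁅E2.pPlus, (v : V.carrier)⁆ := rfl

@[simp] theorem coe_lower {k k' : ℤ} (h : k = k' + 1) (v : weightSpace V.carrier k) :
    (V.lower h v : V.carrier) = ⁅E2.pMinus, (v : V.carrier)⁆ := rfl

variable {m : ℤ}

theorem pMinus_lie_eq_zero
    (hm : ∀ k, k ∉ Set.Icc m (m + 3) → weightSpace V.carrier k = ⊥)
    {v : V.carrier} (hv : v ∈ weightSpace V.carrier m) :
    ⁅E2.pMinus, v⁆ = 0 := by
  have := pMinus_lie_mem (k' := m - 1) (by ring) hv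
  rwa [hm (m - 1) (fun h => by rw [Set.mem_Icc] at h; omega), Submodule.mem_bot] at this

theorem pPlus_lie_eq_zero
    (hm : ∀ k, k ∉ Set.Icc m (m + 3) → weightSpace V.carrier k = ⊥)
    {v : V.carrier} (hv : v ∈ weightSpace V.carrier (m + 3)) :
    ⁅E2.pPlus, v⁆ = 0 := by
  have := pPlus_lie_mem (k' := m + 4) (by ring) hv
  rwa [hm (m + 4) (fun h => by rw [Set.mem_Icc] at h; omega), Submodule.mem_bot] at this

/-- The representation on the weight spaces of a module supported on four consecutive weights. -/
noncomputable def rep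
    (hm : ∀ k, k ∉ Set.Icc m (m + 3) → weightSpace V.carrier k = ⊥) : Rep4.{u} where
  V₁ := weightSpace V.carrier m
  V₂ := weightSpace V.carrier (m + 1)
  V₃ := weightSpace V.carrier (m + 2)
  V₄ := weightSpace V.carrier (m + 3)
  a₁ := V.raise (by ring)
  b₁ := V.lower (by ring)
  a₂ := V.raise (by ring)
  b₂ := V.lower (by ring)
  a₃ := V.raise (by ring)
  b₃ := V.lower (by ring)
  rel₁ v := Subtype.ext <| by
    simp [← pPlus_lie_pMinus_lie, pMinus_lie_eq_zero hm v.2]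
  rel₂ v := Subtype.ext <| by simp [pPlus_lie_pMinus_lie]
  rel₃ v := Subtype.ext <| by simp [pPlus_lie_pMinus_lie]
  rel₄ v := Subtype.ext <| by
    simp [pPlus_lie_pMinus_lie, pPlus_lie_eq_zero hm v.2]

variable (V m) in
/-- The sum map from the product of four consecutive weight spaces. -/
noncomputable def sumMap : (weightSpace V.carrier m × weightSpace V.carrier (m + 1) ×
    weightSpace V.carrier (m + 2) × weightSpace V.carrier (m + 3)) →ₗ[ℂ] V.carrier :=
  (weightSpace V.carrier m).subtype.coprod <| (weightSpace V.carrier (m + 1)).subtype.coprod <|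
    (weightSpace V.carrier (m + 2)).subtype.coprod (weightSpace V.carrier (m + 3)).subtype

theorem sumMap_apply (x : weightSpace V.carrier m × weightSpace V.carrier (m + 1) ×
    weightSpace V.carrier (m + 2) × weightSpace V.carrier (m + 3)) :
    V.sumMap m x = x.1 + (x.2.1 + (x.2.2.1 + x.2.2.2)) := rfl

theorem sumMap_injective : Function.Injective (V.sumMap m) := by
  rw [← LinearMap.ker_eq_bot, LinearMap.ker_eq_bot']
  rintro ⟨⟨x₁, h₁⟩, ⟨x₂, h₂⟩, ⟨x₃, h₃⟩, ⟨x₄, h₄⟩⟩ h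
  rw [sumMap_apply] at h
  have hind := V.iSupIndep_weightSpace.comp (f := fun i : Fin 4 => m + (i : ℤ))
    (fun i j hij => by simpa [Fin.ext_iff] using hij)
  rw [iSupIndep_iff_finsetSum_eq_zero_imp_eq_zero] at hind
  have := hind Finset.univ ![x₁, x₂, x₃, x₄] (fun i _ => by
    fin_cases i
    · simpa using h₁
    · simpa using h₂
    · simpa using h₃
    · simpa using h₄) (by simpa [Fin.sum_univ_four, add_assoc] using h)
  have e₁ := this 0 (Finset.mem_univ _)
  have e₂ := this 1 (Finset.mem_univ _)
  have e₃ := this 2 (Finset.mem_univ _)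
  have e₄ := this 3 (Finset.mem_univ _)
  simp at e₁ e₂ e₃ e₄
  simp [e₁, e₂, e₃, e₄]

theorem sumMap_surjective
    (hm : ∀ k, k ∉ Set.Icc m (m + 3) → weightSpace V.carrier k = ⊥) :
    Function.Surjective (V.sumMap m) := by
  rw [← LinearMap.range_eq_top, eq_top_iff, ← V.iSup_weightSpace]
  refine iSup_le fun k v hv => ?_
  by_cases hk : k ∈ Set.Icc m (m + 3)
  · rw [Set.mem_Icc] at hk
    obtain rfl | rfl | rfl | rfl : k = m ∨ k = m + 1 ∨ k = m + 2 ∨ k = m + 3 := by omega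
    · exact ⟨(⟨v, hv⟩, 0, 0, 0), by simp [sumMap_apply]⟩
    · exact ⟨(0, ⟨v, hv⟩, 0, 0), by simp [sumMap_apply]⟩
    · exact ⟨(0, 0, ⟨v, hv⟩, 0), by simp [sumMap_apply]⟩
    · exact ⟨(0, 0, 0, ⟨v, hv⟩), by simp [sumMap_apply]⟩
  · rw [hm k hk, Submodule.mem_bot] at hv
    exact hv ▸ zero_mem _

/-- A module supported on four consecutive weights is the product of its weight spaces. -/
noncomputable def sumEquiv
    (hm : ∀ k, k ∉ Set.Icc m (m + 3) → weightSpace V.carrier k = ⊥) :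
    (weightSpace V.carrier m × weightSpace V.carrier (m + 1) ×
    weightSpace V.carrier (m + 2) × weightSpace V.carrier (m + 3)) ≃ₗ[ℂ] V.carrier :=
  LinearEquiv.ofBijective (V.sumMap m) ⟨sumMap_injective, sumMap_surjective hm⟩

theorem sumEquiv_apply
    (hm : ∀ k, k ∉ Set.Icc m (m + 3) → weightSpace V.carrier k = ⊥)
    (x : weightSpace V.carrier m × weightSpace V.carrier (m + 1) ×
    weightSpace V.carrier (m + 2) × weightSpace V.carrier (m + 3)) :
    sumEquiv hm x = x.1 + (x.2.1 + (x.2.2.1 + x.2.2.2)) := rfl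

theorem isCompl_prod {E F : Type*} [AddCommGroup E] [Module ℂ E] [AddCommGroup F] [Module ℂ F]
    {M N : Submodule ℂ E} {M' N' : Submodule ℂ F} (h : IsCompl M N) (h' : IsCompl M' N') :
    IsCompl (M.prod M') (N.prod N') := by
  rw [isCompl_iff, disjoint_iff, codisjoint_iff, Submodule.prod_inf_prod, Submodule.prod_sup_prod,
    h.inf_eq_bot, h'.inf_eq_bot, h.sup_eq_top, h'.sup_eq_top]
  simp

variable {M₁ : Submodule ℂ (weightSpace V.carrier m)}
  {M₂ : Submodule ℂ (weightSpace V.carrier (m + 1))}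
  {M₃ : Submodule ℂ (weightSpace V.carrier (m + 2))}
  {M₄ : Submodule ℂ (weightSpace V.carrier (m + 3))}

theorem mem_map_sumEquiv
    (hm : ∀ k, k ∉ Set.Icc m (m + 3) → weightSpace V.carrier k = ⊥)
    {v : V.carrier} :
    v ∈ (M₁.prod (M₂.prod (M₃.prod M₄))).map (sumEquiv hm).toLinearMap ↔
      ∃ x₁ ∈ M₁, ∃ x₂ ∈ M₂, ∃ x₃ ∈ M₃, ∃ x₄ ∈ M₄,
        (x₁ + (x₂ + (x₃ + x₄)) : V.carrier) = v := by
  simp only [Submodule.mem_map, Submodule.mem_prod, Prod.exists, LinearEquiv.coe_coe,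
    sumEquiv_apply]
  tauto

theorem pPlus_lie_mem_map_sumEquiv
    (hm : ∀ k, k ∉ Set.Icc m (m + 3) → weightSpace V.carrier k = ⊥)
    (h₁ : M₁ ≤ M₂.comap (V.raise (by ring)))
    (h₂ : M₂ ≤ M₃.comap (V.raise (by ring))) (h₃ : M₃ ≤ M₄.comap (V.raise (by ring)))
    {v : V.carrier} (hv : v ∈ (M₁.prod (M₂.prod (M₃.prod M₄))).map (sumEquiv hm).toLinearMap) :
    ⁅E2.pPlus, v⁆ ∈ (M₁.prod (M₂.prod (M₃.prod M₄))).map (sumEquiv hm).toLinearMap := by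
  rw [mem_map_sumEquiv] at hv ⊢
  obtain ⟨x₁, k₁, x₂, k₂, x₃, k₃, x₄, k₄, rfl⟩ := hv
  refine ⟨0, zero_mem _, _, mem_comap.1 (h₁ k₁), _, mem_comap.1 (h₂ k₂), _, mem_comap.1 (h₃ k₃), ?_⟩
  rw [coe_raise, coe_raise, coe_raise, lie_add, lie_add, lie_add, pPlus_lie_eq_zero hm x₄.2,
    add_zero, ZeroMemClass.coe_zero, zero_add]

theorem pMinus_lie_mem_map_sumEquiv
    (hm : ∀ k, k ∉ Set.Icc m (m + 3) → weightSpace V.carrier k = ⊥)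
    (h₁ : M₂ ≤ M₁.comap (V.lower (by ring)))
    (h₂ : M₃ ≤ M₂.comap (V.lower (by ring))) (h₃ : M₄ ≤ M₃.comap (V.lower (by ring)))
    {v : V.carrier} (hv : v ∈ (M₁.prod (M₂.prod (M₃.prod M₄))).map (sumEquiv hm).toLinearMap) :
    ⁅E2.pMinus, v⁆ ∈ (M₁.prod (M₂.prod (M₃.prod M₄))).map (sumEquiv hm).toLinearMap := by
  rw [mem_map_sumEquiv] at hv ⊢
  obtain ⟨x₁, k₁, x₂, k₂, x₃, k₃, x₄, k₄, rfl⟩ := hv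
  refine ⟨_, mem_comap.1 (h₁ k₂), _, mem_comap.1 (h₂ k₃), _, mem_comap.1 (h₃ k₄), 0, zero_mem _, ?_⟩
  rw [coe_lower, coe_lower, coe_lower, lie_add, lie_add, lie_add, pMinus_lie_eq_zero hm x₁.2,
    ZeroMemClass.coe_zero, zero_add, add_zero]

theorem l_lie_mem_map_sumEquiv
    (hm : ∀ k, k ∉ Set.Icc m (m + 3) → weightSpace V.carrier k = ⊥)
    {v : V.carrier} (hv : v ∈ (M₁.prod (M₂.prod (M₃.prod M₄))).map (sumEquiv hm).toLinearMap) :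
    ⁅E2.l, v⁆ ∈ (M₁.prod (M₂.prod (M₃.prod M₄))).map (sumEquiv hm).toLinearMap := by
  rw [mem_map_sumEquiv] at hv ⊢
  obtain ⟨x₁, k₁, x₂, k₂, x₃, k₃, x₄, k₄, rfl⟩ := hv
  refine ⟨_, M₁.smul_mem (m : ℂ) k₁, _, M₂.smul_mem ((m + 1 : ℤ) : ℂ) k₂,
    _, M₃.smul_mem ((m + 2 : ℤ) : ℂ) k₃, _, M₄.smul_mem ((m + 3 : ℤ) : ℂ) k₄, ?_⟩
  rw [lie_add, lie_add, lie_add, mem_weightSpace.1 x₁.2, mem_weightSpace.1 x₂.2,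
    mem_weightSpace.1 x₃.2, mem_weightSpace.1 x₄.2, coe_smul, coe_smul,
    coe_smul, coe_smul]

theorem lie_mem_map_sumEquiv
    (hm : ∀ k, k ∉ Set.Icc m (m + 3) → weightSpace V.carrier k = ⊥)
    (hM : (rep hm).Stable M₁ M₂ M₃ M₄) (v : V.carrier)
    (hv : v ∈ (M₁.prod (M₂.prod (M₃.prod M₄))).map (sumEquiv hm).toLinearMap) :
    ⁅E2.pPlus, v⁆ ∈ (M₁.prod (M₂.prod (M₃.prod M₄))).map (sumEquiv hm).toLinearMap ∧
    ⁅E2.pMinus, v⁆ ∈ (M₁.prod (M₂.prod (M₃.prod M₄))).map (sumEquiv hm).toLinearMap ∧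
    ⁅E2.l, v⁆ ∈ (M₁.prod (M₂.prod (M₃.prod M₄))).map (sumEquiv hm).toLinearMap :=
  ⟨pPlus_lie_mem_map_sumEquiv hm hM.a₁ hM.a₂ hM.a₃ hv,
    pMinus_lie_mem_map_sumEquiv hm hM.b₁ hM.b₂ hM.b₃ hv, l_lie_mem_map_sumEquiv hm hv⟩

theorem eq_bot_of_map_sumEquiv
    (hm : ∀ k, k ∉ Set.Icc m (m + 3) → weightSpace V.carrier k = ⊥)
    (h : (M₁.prod (M₂.prod (M₃.prod M₄))).map (sumEquiv hm).toLinearMap = ⊥) :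
    M₁ = ⊥ ∧ M₂ = ⊥ ∧ M₃ = ⊥ ∧ M₄ = ⊥ := by
  have h := Submodule.map_injective_of_injective (sumEquiv hm).injective
    (h.trans (Submodule.map_bot _).symm)
  rwa [prod_eq_bot_iff, prod_eq_bot_iff, prod_eq_bot_iff] at h

/-- A splitting of the representation sums, vertex by vertex, to a splitting of the module. -/
theorem Indecomposable.rep_indec
    (hm : ∀ k, k ∉ Set.Icc m (m + 3) → weightSpace V.carrier k = ⊥)
    (hV : V.Indecomposable) : (rep hm).Indec := by
  intro M₁ N₁ M₂ N₂ M₃ N₃ M₄ N₄ hM hN h₁ h₂ h₃ h₄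
  have hc := isCompl_prod h₁ (isCompl_prod h₂ (isCompl_prod h₃ h₄))
  have hc' := (Submodule.orderIsoMapComap (sumEquiv hm)).isCompl hc
  exact (hV.eq_bot_or_eq_bot (lie_mem_map_sumEquiv hm hM) (lie_mem_map_sumEquiv hm hN) hc').imp
    (eq_bot_of_map_sumEquiv hm) (eq_bot_of_map_sumEquiv hm)

end Rep

theorem hasSignBasis_of_bases {m : ℤ}
    (hm : ∀ k, k ∉ Set.Icc m (m + 3) → weightSpace V.carrier k = ⊥) {n₁ n₂ n₃ n₄ : ℕ}
    (e₁ : Basis (Fin n₁) ℂ (weightSpace V.carrier m))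
    (e₂ : Basis (Fin n₂) ℂ (weightSpace V.carrier (m + 1)))
    (e₃ : Basis (Fin n₃) ℂ (weightSpace V.carrier (m + 2)))
    (e₄ : Basis (Fin n₄) ℂ (weightSpace V.carrier (m + 3)))
    {a₁ : Fin n₁ → Fin n₂ → SignType} {b₁ : Fin n₂ → Fin n₁ → SignType}
    {a₂ : Fin n₂ → Fin n₃ → SignType} {b₂ : Fin n₃ → Fin n₂ → SignType}
    {a₃ : Fin n₃ → Fin n₄ → SignType} {b₃ : Fin n₄ → Fin n₃ → SignType}
    (ha₁ : ∀ j, V.raise (by ring) (e₁ j) = ∑ i, ((a₁ j i : SignType) : ℂ) • e₂ i)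
    (hb₁ : ∀ j, V.lower (by ring) (e₂ j) = ∑ i, ((b₁ j i : SignType) : ℂ) • e₁ i)
    (ha₂ : ∀ j, V.raise (by ring) (e₂ j) = ∑ i, ((a₂ j i : SignType) : ℂ) • e₃ i)
    (hb₂ : ∀ j, V.lower (by ring) (e₃ j) = ∑ i, ((b₂ j i : SignType) : ℂ) • e₂ i)
    (ha₃ : ∀ j, V.raise (by ring) (e₃ j) = ∑ i, ((a₃ j i : SignType) : ℂ) • e₄ i)
    (hb₃ : ∀ j, V.lower (by ring) (e₄ j) = ∑ i, ((b₃ j i : SignType) : ℂ) • e₃ i) :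
    V.HasSignBasis (ι := Fin n₁ ⊕ Fin n₂ ⊕ Fin n₃ ⊕ Fin n₄)
      (Sum.elim (fun _ => m) <| Sum.elim (fun _ => m + 1) <| Sum.elim (fun _ => m + 2)
        fun _ => m + 3)
      (Sum.elim (fun j => Sum.elim 0 (Sum.elim (a₁ j) 0)) <|
        Sum.elim (fun j => Sum.elim 0 (Sum.elim 0 (Sum.elim (a₂ j) 0))) <|
        Sum.elim (fun j => Sum.elim 0 (Sum.elim 0 (Sum.elim 0 (a₃ j)))) fun _ => 0)
      (Sum.elim (fun _ => 0) <| Sum.elim (fun j => Sum.elim (b₁ j) 0) <|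
        Sum.elim (fun j => Sum.elim 0 (Sum.elim (b₂ j) 0)) <|
        fun j => Sum.elim 0 (Sum.elim 0 (Sum.elim (b₃ j) 0))) := by
  have H : ∀ {k : ℤ} (v : weightSpace V.carrier k),
      ⁅E2.l, (v : V.carrier)⁆ = (k : ℂ) • (v : V.carrier) := fun v => mem_weightSpace.1 v.2
  have cp : ∀ {k k' : ℤ} (h : k' = k + 1) {n : ℕ} {v : weightSpace V.carrier k}
      {t : Fin n → SignType} {e : Fin n → weightSpace V.carrier k'},
      V.raise h v = ∑ i, ((t i : SignType) : ℂ) • e i →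
      ⁅E2.pPlus, (v : V.carrier)⁆ = ∑ i, ((t i : SignType) : ℂ) • (e i : V.carrier) := by
    intro k k' h n v t e he
    rw [← coe_raise h, he]
    simp
  have cm : ∀ {k k' : ℤ} (h : k = k' + 1) {n : ℕ} {v : weightSpace V.carrier k}
      {t : Fin n → SignType} {e : Fin n → weightSpace V.carrier k'},
      V.lower h v = ∑ i, ((t i : SignType) : ℂ) • e i →
      ⁅E2.pMinus, (v : V.carrier)⁆ = ∑ i, ((t i : SignType) : ℂ) • (e i : V.carrier) := by
    intro k k' h n v t e he
    rw [← coe_lower h, he]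
    simp
  refine ⟨(e₁.prod (e₂.prod (e₃.prod e₄))).map (sumEquiv hm), ?_, ?_, ?_⟩
  · rintro (j | j | j | j) <;> simp [sumEquiv_apply, H]
  · rintro (j | j | j | j)
    · simp [sumEquiv_apply, cp _ (ha₁ j)]
    · simp [sumEquiv_apply, cp _ (ha₂ j)]
    · simp [sumEquiv_apply, cp _ (ha₃ j)]
    · simp [sumEquiv_apply, pPlus_lie_eq_zero hm (e₄ j).2]
  · rintro (j | j | j | j)
    · simp [sumEquiv_apply, pMinus_lie_eq_zero hm (e₁ j).2]
    · simp [sumEquiv_apply, cm _ (hb₁ j)]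
    · simp [sumEquiv_apply, cm _ (hb₂ j)]
    · simp [sumEquiv_apply, cm _ (hb₃ j)]

theorem hasSignBasis_of_nice {m : ℤ}
    (hm : ∀ k, k ∉ Set.Icc m (m + 3) → weightSpace V.carrier k = ⊥)
    (h : (rep hm).Nice) :
    ∃ d ≤ 8, ∃ (w : Fin d → ℤ) (p q : Fin d → Fin d → SignType), V.HasSignBasis w p q := by
  obtain ⟨n₁, n₂, n₃, n₄, h₁, h₂, h₃, h₄, e₁, e₂, e₃, e₄, ha₁, hb₁, ha₂, hb₂, ha₃, hb₃⟩ := h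
  choose a₁ ha₁ using ha₁
  choose b₁ hb₁ using hb₁
  choose a₂ ha₂ using ha₂
  choose b₂ hb₂ using hb₂
  choose a₃ ha₃ using ha₃
  choose b₃ hb₃ using hb₃
  have hcard : Fintype.card (Fin n₁ ⊕ Fin n₂ ⊕ Fin n₃ ⊕ Fin n₄) = n₁ + (n₂ + (n₃ + n₄)) := by simp
  exact ⟨_, by omega, _, _, _, (hasSignBasis_of_bases hm e₁ e₂ e₃ e₄ ha₁ hb₁ ha₂ hb₂ ha₃
    hb₃).reindex (Fintype.equivFinOfCardEq hcard)⟩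

end E2Mod

end Euclidean

/-! ### The finiteness theorem -/

theorem mainTheorem5 (A : Finset ℤ) (hA : ∀ a : ℤ, ¬ Finset.Icc a (a + 4) ⊆ A) :
    {c : Euclidean.E2Mod.IsoClass.{u} | ∃ V : Euclidean.E2Mod.{u},
      V.Indecomposable ∧ V.SupportedOn (A : Set ℤ) ∧ V.isoClass = c}.Finite := by
  -- Dimensions run up to 8, two for each of four weights. Restricting the weights to `A` makes this
  -- type finite.
  let T : Type := Σ d : Fin 9, (Fin d → A) × (Fin d → Fin d → SignType) ×
    (Fin d → Fin d → SignType)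
  let C : T → Set Euclidean.E2Mod.IsoClass.{u} := fun t =>
    {c | ∃ V : Euclidean.E2Mod.{u},
      V.HasSignBasis (fun i => (t.2.1 i : ℤ)) t.2.2.1 t.2.2.2 ∧ V.isoClass = c}
  have hC : ∀ t, (C t).Finite := by
    intro t
    refine Set.Subsingleton.finite ?_
    rintro _ ⟨V, hV, rfl⟩ _ ⟨W, hW, rfl⟩
    exact hV.isoClass_eq hW
  refine (Set.finite_iUnion hC).subset ?_
  rintro _ ⟨V, hV, hVA, rfl⟩
  obtain ⟨m, hm⟩ := hV.exists_interval hA hVA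
  have hne : (∃ x : (Euclidean.E2Mod.rep hm).V₁, x ≠ 0) ∨
      (∃ x : (Euclidean.E2Mod.rep hm).V₂, x ≠ 0) ∨
      (∃ x : (Euclidean.E2Mod.rep hm).V₃, x ≠ 0) ∨ ∃ x : (Euclidean.E2Mod.rep hm).V₄, x ≠ 0 := by
    obtain ⟨k, hk⟩ := hV.exists_weightSpace_ne_bot
    have hmem : k ∈ Set.Icc m (m + 3) := by
      by_contra h
      exact hk (hm k h)
    obtain ⟨x, hx, hx0⟩ := Submodule.exists_mem_ne_zero_of_ne_bot hk
    have hx' : ∀ {k}, ∀ h : x ∈ Euclidean.weightSpace V.carrier k,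
        (⟨x, h⟩ : Euclidean.weightSpace V.carrier k) ≠ 0 :=
      fun h h' => hx0 (congrArg Subtype.val h')
    rw [Set.mem_Icc] at hmem
    obtain rfl | rfl | rfl | rfl : k = m ∨ k = m + 1 ∨ k = m + 2 ∨ k = m + 3 := by omega
    · exact .inl ⟨⟨x, hx⟩, hx' hx⟩
    · exact .inr (.inl ⟨⟨x, hx⟩, hx' hx⟩)
    · exact .inr (.inr (.inl ⟨⟨x, hx⟩, hx' hx⟩))
    · exact .inr (.inr (.inr ⟨⟨x, hx⟩, hx' hx⟩))
  obtain ⟨d, hd, w, p, q, hVd⟩ := Euclidean.E2Mod.hasSignBasis_of_nice hm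
    ((hV.rep_indec hm).nice hne)
  -- A basis vector is a nonzero weight vector, so its weight is in the support.
  have hw : ∀ i, w i ∈ A := by
    intro i
    by_contra h
    obtain ⟨e, hl, -⟩ := hVd
    have := Euclidean.mem_weightSpace.2 (hl i)
    rw [hVA (w i) (by simpa using h), Submodule.mem_bot] at this
    exact e.ne_zero i this
  exact Set.mem_iUnion.2 ⟨⟨⟨d, by omega⟩, fun i => ⟨w i, hw i⟩, p, q⟩, V, hVd, rfl⟩
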